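/- **Theorem.** Let $f:\mathbb{R}^m\times\mathbb{R}^n\to\mathbb{R}$ be $L$-Lipschitz (jointly, for the Euclidean norm, $L>0$), let $f(\cdot,\mathbf y)$ be $\rho$-weakly convex for every $\mathbf y$ (that is, $f(\cdot,\mathbf y)+\frac{\rho}{2}\|\cdot\|^2$ is convex, $\rho>0$), and let $f(\mathbf x,\cdot)$ be concave for every $\mathbf x$. Let $\mathcal Y\subseteq\mathbb{R}^n$ be closed, convex and bounded, of diameter at most $D$ (with $D>0$). Put $\Phi(\mathbf x)=\max_{\mathbf y\in\mathcal Y}f(\mathbf x,\mathbf y)$ and assume that $\Phi$ is bounded below. Let $\mathbf x_0\in\mathbb{R}^m$, $\mathbf y_0\in\mathcal Y$, $\Delta_\Phi=\Phi(\mathbf x_0)-\inf_{\mathbf x}\Phi(\mathbf x)$ and $\epsilon>0$. Let $\Phi_{1/2\rho}(\mathbf x)=\min_{\mathbf w}\{\Phi(\mathbf w)+\rho\|\mathbf w-\mathbf x\|^2\}$ be the Moreau envelope; a point $\mathbf x$ is $\epsilon$-stationary if $\Phi_{1/2\rho}$ is differentiable at $\mathbf x$ and $\|\nabla\Phi_{1/2\rho}(\mathbf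 x)\|\le\epsilon$. Let $\partial f$ denote the Clarke subdifferential of $f$ on $\mathbb{R}^m\times\mathbb{R}^n$ and $\mathcal P_{\mathcal Y}$ the orthogonal projection onto $\mathcal Y$. There is an absolute constant $C>0$, independent of all the data above and below, such that the following hold. 1. (TTGDA.) Let $$\eta_{\mathbf x}=\min\Big\{\tfrac{\epsilon^2}{48\rho L^2},\tfrac{\epsilon^6}{65536\rho^3L^4D^2}\Big\},\qquad \eta_{\mathbf y}=\tfrac{\epsilon^2}{16\rho L^2}.$$ There is an integer $N\ge 0$ with $$N\le C\,\tfrac{\rho L^2\Delta_\Phi}{\epsilon^4}\max\Big\{1,\tfrac{\rho^2L^2D^2}{\epsilon^4}\Big\}$$ such that for every $T\ge N$ and all iterates $\mathbf x_{t+1}=\mathbf x_t-\eta_{\mathbf x}\mathbf g_{\mathbf x}^t$, $\mathbf y_{t+1}=\mathcal P_{\mathcal Y}(\mathbf y_t+\eta_{\mathbf y}\mathbf g_{\mathbf y}^t)$ with $(\mathbf g_{\mathbf x}^t,\mathbf g_{\mathbf y}^t)\in\partial f(\mathbf x_t,\mathbf y_t)$, $0\le t<T$ (a run that uses $T$ gradient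 evaluations), $\Phi_{1/2\rho}$ is differentiable at all the $\mathbf x_t$, $0\le t\le T$, the point $\hat{\mathbf x}$ drawn uniformly from $\{\mathbf x_t\}_{t=0}^T$ satisfies $\mathbb E\|\nabla\Phi_{1/2\rho}(\hat{\mathbf x})\|^2\le\epsilon^2$, and at least one of $\mathbf x_0,\dots,\mathbf x_T$ is $\epsilon$-stationary. 2. (TTSGDA with batch size $M=1$.) Let $\sigma\ge0$ and let $G(\mathbf x,\mathbf y,\xi)\in\mathbb{R}^m\times\mathbb{R}^n$, with $\xi\sim\nu$, be a (jointly measurable, square-integrable) stochastic oracle such that, for all $\mathbf x\in\mathbb{R}^m$ and $\mathbf y\in\mathcal Y$, $\mathbb E\,G(\mathbf x,\mathbf y,\xi)\in\partial f(\mathbf x,\mathbf y)$ and $\mathbb E\|G(\mathbf x,\mathbf y,\xi)-\mathbb E\,G(\mathbf x,\mathbf y,\xi)\|^2\le\sigma^2$. Let $$\eta_{\mathbf x}=\min\Big\{\tfrac{\epsilon^2}{48\rho(L^2+\sigma^2)},\tfrac{\epsilon^6}{131072\rho^3(L^2+\sigma^2)^2D^2}\Big\},\qquad \eta_{\mathbf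 y}=\tfrac{\epsilon^2}{32\rho(L^2+\sigma^2)}.$$ There is an integer $N\ge 0$ with $$N\le C\,\tfrac{\rho(L^2+\sigma^2)\Delta_\Phi}{\epsilon^4}\max\Big\{1,\tfrac{\rho^2(L^2+\sigma^2)D^2}{\epsilon^4}\Big\},$$ depending only on $f,\mathcal Y,L,\rho,D,\epsilon,\sigma$ and the starting point, such that for every $T\ge N$, every such oracle and i.i.d. samples $\xi^0,\xi^1,\dots\sim\nu$, the iterates $\mathbf x_{t+1}=\mathbf x_t-\eta_{\mathbf x}G_{\mathbf x}(\mathbf x_t,\mathbf y_t,\xi^t)$, $\mathbf y_{t+1}=\mathcal P_{\mathcal Y}(\mathbf y_t+\eta_{\mathbf y}G_{\mathbf y}(\mathbf x_t,\mathbf y_t,\xi^t))$, $0\le t<T$ (a run that uses $T$ stochastic gradient evaluations), have the property that $\Phi_{1/2\rho}$ is differentiable at all the $\mathbf x_t$, $0\le t\le T$, and that the point $\hat{\mathbf x}$ drawn uniformly, independently of the samples, from $\{\mathbf x_t\}_{t=0}^T$ satisfies $\mathbb E\|\nabla\Phi_{1/2\rho}(\hat{\mathbf x})\|^2\le\epsilon^2$.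 -/

import Mathlib

open MeasureTheory ProbabilityTheory Filter Topology Set
open scoped NNReal

noncomputable section

namespace Minimax

section Analysis

variable {V : Type*} [NormedAddCommGroup V] [InnerProductSpace ℝ V]

/-- `h` is `ρ`-weakly convex: `h + (ρ/2)‖·‖²` is convex. -/
def WeaklyConvex (ρ : ℝ) (h : V → ℝ) : Prop :=
  ConvexOn ℝ univ fun x => h x + ρ / 2 * ‖x‖ ^ 2

/-- Clarke's generalized directional derivative
`h°(z; v) = limsup_{z' → z, t ↓ 0} (h (z' + t v) - h z') / t`, as an extended real. -/
def clarkeDeriv (h : V → ℝ) (z v : V) : EReal :=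
  limsup (fun p : V × ℝ => (((h (p.1 + p.2 • v) - h p.1) / p.2 : ℝ) : EReal))
    (𝓝 z ×ˢ 𝓝[>] (0 : ℝ))

/-- The Clarke subdifferential `∂h(z) = {g : ⟪g, v⟫ ≤ h°(z; v) for all v}`. -/
def clarkeSubdifferential (h : V → ℝ) (z : V) : Set V :=
  {g | ∀ v, ((inner ℝ g v : ℝ) : EReal) ≤ clarkeDeriv h z v}

/-- The Moreau envelope `h_lam(x) = min_w h(w) + ‖w - x‖² / (2 lam)`. -/
def moreauEnvelope (h : V → ℝ) (lam : ℝ) (x : V) : ℝ :=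
  ⨅ w, (h w + 1 / (2 * lam) * ‖w - x‖ ^ 2)

/-- `x` is an `ε`-stationary point of the `ρ`-weakly convex function `h`: the Moreau envelope
`h_{1/(2ρ)}` has a gradient of norm at most `ε` at `x`. -/
def IsEpsStationary [CompleteSpace V] (h : V → ℝ) (ρ ε : ℝ) (x : V) : Prop :=
  DifferentiableAt ℝ (moreauEnvelope h (1 / (2 * ρ))) x ∧
    ‖gradient (moreauEnvelope h (1 / (2 * ρ))) x‖ ≤ ε

/-- The random point `X` is `ε`-stationary in expectation: `E ‖∇h_{1/(2ρ)}(X)‖² ≤ ε²`. -/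
def IsEpsStationaryInMean [CompleteSpace V] {S : Type*} [MeasurableSpace S] (P : Measure S)
    (h : V → ℝ) (ρ ε : ℝ) (X : S → V) : Prop :=
  (∀ s, DifferentiableAt ℝ (moreauEnvelope h (1 / (2 * ρ))) (X s)) ∧
    Integrable (fun s => ‖gradient (moreauEnvelope h (1 / (2 * ρ))) (X s)‖ ^ 2) P ∧
    ∫ s, ‖gradient (moreauEnvelope h (1 / (2 * ρ))) (X s)‖ ^ 2 ∂P ≤ ε ^ 2

/-- The orthogonal projection of `z` onto `Y`: a point of `Y` nearest to `z`. It exists and is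
unique when `Y` is closed, convex and non-empty, see `proj_spec` and `proj_unique`. -/
def proj (Y : Set V) (z : V) : V :=
  Classical.epsilon fun p => p ∈ Y ∧ ∀ q ∈ Y, ‖z - p‖ ≤ ‖z - q‖

theorem proj_spec [CompleteSpace V] {Y : Set V} (hne : Y.Nonempty) (hcl : IsClosed Y)
    (hco : Convex ℝ Y) (z : V) : proj Y z ∈ Y ∧ ∀ q ∈ Y, ‖z - proj Y z‖ ≤ ‖z - q‖ := by
  refine Classical.epsilon_spec (p := fun p => p ∈ Y ∧ ∀ q ∈ Y, ‖z - p‖ ≤ ‖z - q‖) ?_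
  obtain ⟨p, hp, h⟩ := exists_norm_eq_iInf_of_complete_convex hne hcl.isComplete hco z
  refine ⟨p, hp, fun q hq => ?_⟩
  rw [h]
  exact ciInf_le ⟨0, by rintro _ ⟨w, rfl⟩; exact norm_nonneg _⟩ (⟨q, hq⟩ : Y)

theorem proj_unique [CompleteSpace V] {Y : Set V} (hne : Y.Nonempty) (hcl : IsClosed Y)
    (hco : Convex ℝ Y) (z p : V) (hp : p ∈ Y) (hmin : ∀ q ∈ Y, ‖z - p‖ ≤ ‖z - q‖) :
    p = proj Y z := by
  obtain ⟨h1, h2⟩ := proj_spec hne hcl hco z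
  have key : ∀ a ∈ Y, (∀ q ∈ Y, ‖z - a‖ ≤ ‖z - q‖) → ∀ w ∈ Y, inner ℝ (z - a) (w - a) ≤ 0 := by
    intro a ha hm
    refine (norm_eq_iInf_iff_real_inner_le_zero hco ha).1 (le_antisymm ?_ ?_)
    · have : Nonempty Y := ⟨⟨a, ha⟩⟩
      exact le_ciInf fun w => hm w w.2
    · exact ciInf_le ⟨0, by rintro _ ⟨w, rfl⟩; exact norm_nonneg _⟩ (⟨a, ha⟩ : Y)
  have e1 := key p hp hmin _ h1
  have e2 := key _ h1 h2 p hp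
  have e3 : inner ℝ (p - proj Y z) (p - proj Y z) ≤ (0 : ℝ) := by
    have : inner ℝ (p - proj Y z) (p - proj Y z)
        = inner ℝ (z - p) (proj Y z - p) + inner ℝ (z - proj Y z) (p - proj Y z) := by
      rw [← neg_sub p (proj Y z), inner_neg_right, ← sub_eq_neg_add, ← inner_sub_left]
      congr 1
      abel
    linarith
  exact sub_eq_zero.1 (inner_self_eq_zero.1 (le_antisymm e3 real_inner_self_nonneg))

end Analysis

section Problem

variable {E F : Type*} [NormedAddCommGroup E] [InnerProductSpace ℝ E]
  [NormedAddCommGroup F] [InnerProductSpace ℝ F]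

/-- `f` as a function on the Euclidean product space. -/
def joint (f : E → F → ℝ) : WithLp 2 (E × F) → ℝ := fun p => f p.fst p.snd

/-- `Φ(x) = max_{y ∈ Y} f(x, y)`. -/
def primal (f : E → F → ℝ) (Y : Set F) (x : E) : ℝ := ⨆ y : Y, f x y

/-- The joint Clarke subdifferential `∂f(x, y)`. -/
def subdiff (f : E → F → ℝ) (x : E) (y : F) : Set (WithLp 2 (E × F)) :=
  clarkeSubdifferential (joint f) (WithLp.toLp 2 (x, y))

/-- The problem class: `f` is `L`-Lipschitz on the Euclidean product, `ρ`-weakly convex in `x` and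
concave in `y`; `Y` is closed, convex and bounded with diameter at most `D`. -/
structure IsNonconvexConcave (f : E → F → ℝ) (Y : Set F) (L : ℝ≥0) (ρ D : ℝ) : Prop where
  lipschitz : LipschitzWith L (joint f)
  weaklyConvex : ∀ y, WeaklyConvex ρ fun x => f x y
  concave : ∀ x, ConcaveOn ℝ univ (f x)
  closed : IsClosed Y
  convex : Convex ℝ Y
  bounded : Bornology.IsBounded Y
  diam_le : Metric.diam Y ≤ D

/-- `Δ_Φ = Φ(x₀) - inf_x Φ(x)`. -/
def gap (f : E → F → ℝ) (Y : Set F) (x₀ : E) : ℝ := primal f Y x₀ - ⨅ x, primal f Y x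

/-- `(x_t, y_t)`, `0 ≤ t ≤ T`, are iterates of `T` iterations of two-timescale (sub)gradient descent
ascent with step sizes `ηx t`, `ηy t`, started at `(x₀, y₀)`: every iteration evaluates one
(arbitrary) element of `∂f` at the current iterate. -/
structure IsTTGDARun (f : E → F → ℝ) (Y : Set F) (ηx ηy : ℕ → ℝ) (x₀ : E) (y₀ : F) (T : ℕ)
    (x : ℕ → E) (y : ℕ → F) : Prop where
  init_x : x 0 = x₀
  init_y : y 0 = y₀
  step : ∀ t < T, ∃ g ∈ subdiff f (x t) (y t),
    x (t + 1) = x t - ηx t • g.fst ∧ y (t + 1) = proj Y (y t + ηy t • g.snd)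

/-- Number of gradient evaluations in `T` iterations of the deterministic method. -/
def ttgdaEvals (T : ℕ) : ℕ := T

/-- The index drawn uniformly from `{0, …, T}` that selects the returned iterate. -/
def uniformIndex (T : ℕ) : Measure (Fin (T + 1)) := (PMF.uniformOfFintype (Fin (T + 1))).toMeasure

/-- A stochastic gradient oracle `G(x, y, ξ)`, `ξ ∼ ν`, that is unbiased, `E G(x, y, ξ) ∈ ∂f(x, y)`,
with variance bounded by `σ²`. -/
structure IsOracle [MeasurableSpace E] [MeasurableSpace F] {Ξ : Type*} [MeasurableSpace Ξ]
    (f : E → F → ℝ) (Y : Set F) (ν : Measure Ξ) (σ : ℝ) (G : E → F → Ξ → WithLp 2 (E × F)) :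
    Prop where
  measurable : Measurable fun p : (E × F) × Ξ => G p.1.1 p.1.2 p.2
  memLp : ∀ x, ∀ y ∈ Y, MemLp (G x y) 2 ν
  unbiased : ∀ x, ∀ y ∈ Y, (∫ s, G x y s ∂ν) ∈ subdiff f x y
  variance_le : ∀ x, ∀ y ∈ Y, ∫ s, ‖G x y s - ∫ s', G x y s' ∂ν‖ ^ 2 ∂ν ≤ σ ^ 2

/-- The mini-batch average `(1/M) ∑ᵢ G(x, y, ξᵢ)`. -/
def miniBatch {Ξ : Type*} {M : ℕ} (G : E → F → Ξ → WithLp 2 (E × F)) (ξ : Fin M → Ξ) (x : E)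
    (y : F) : WithLp 2 (E × F) :=
  (1 / (M : ℝ)) • ∑ i, G x y (ξ i)

/-- The iterates `(x_t, y_t)` of two-timescale stochastic gradient descent ascent with batch size
`M`, for a given sequence of samples `ξ t i`. -/
def ttsgda {Ξ : Type*} {M : ℕ} (Y : Set F) (ηx ηy : ℕ → ℝ) (G : E → F → Ξ → WithLp 2 (E × F))
    (x₀ : E) (y₀ : F) (ξ : ℕ → Fin M → Ξ) : ℕ → E × F
  | 0 => (x₀, y₀)
  | t + 1 =>
    let z := ttsgda Y ηx ηy G x₀ y₀ ξ t
    let g := miniBatch G (ξ t) z.1 z.2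
    (z.1 - ηx t • g.fst, proj Y (z.2 + ηy t • g.snd))

/-- Number of stochastic gradient evaluations in `T` iterations with batch size `M`. -/
def ttsgdaEvals (M T : ℕ) : ℕ := M * T

end Problem

end Minimax

end

open Minimax

/-!
The Moreau envelope of `Φ` is differentiable with gradient `2 ρ (x - prox x)`, and a step from
`x_t` along the partial gradient of `f (·, y_t)` decreases it up to an error `2 ρ` times the dual
gap `Φ x_t - f (x_t, y_t)`. If `x` were fixed, projected ascent in `y` would bound the average dual
gap in the usual way. Since `x` moves much more slowly than `y`, over a block of length of order
`κ = ρ² S D² / ε⁴` an almost optimal reply to the first `x` of the block stays almost optimal, so it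
serves as the comparator in that argument. A run shorter than one block only reaches the prescribed
length when `Φ x₀ - inf Φ` is already of order `ε² / ρ`, and then every gradient along the run is
small.
-/

namespace Minimax

section StrongConvexity

section NormedSpace

variable {V : Type*} [NormedAddCommGroup V] [NormedSpace ℝ V] {s : Set V} {φ : V → ℝ} {m : ℝ}

theorem add_sq_norm_sub_le_of_isMinOn_of_strongConvexOn (hφ : StrongConvexOn s m φ) {p w : V}
    (hp : p ∈ s) (hmin : IsMinOn φ s p) (hw : w ∈ s) : φ p + m / 2 * ‖w - p‖ ^ 2 ≤ φ w := by
  have on_segment : ∀ t ∈ Ioo (0 : ℝ) 1, φ p + m / 2 * (1 - t) * ‖w - p‖ ^ 2 ≤ φ w := by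
    intro t ht
    have hle := (hmin (hφ.1 hp hw (sub_nonneg.2 ht.2.le) ht.1.le (by ring))).trans
      (hφ.2 hp hw (sub_nonneg.2 ht.2.le) ht.1.le (by ring))
    simp only [smul_eq_mul, norm_sub_rev p w] at hle
    exact le_of_mul_le_mul_left (by linarith) ht.1
  have hlim : Tendsto (fun t : ℝ => φ p + m / 2 * (1 - t) * ‖w - p‖ ^ 2) (𝓝[>] 0)
      (𝓝 (φ p + m / 2 * (1 - 0) * ‖w - p‖ ^ 2)) :=
    (Continuous.tendsto (by fun_prop) 0).mono_left nhdsWithin_le_nhds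
  simpa using le_of_tendsto hlim (eventually_of_mem (Ioo_mem_nhdsGT zero_lt_one) on_segment)

theorem exists_isMinOn_of_strongConvexOn [CompleteSpace V] (hφ : StrongConvexOn s m φ)
    (hm : 0 < m) (hs : IsClosed s) (hne : s.Nonempty) (hcont : ContinuousOn φ s)
    (hbdd : BddBelow (φ '' s)) : ∃ p ∈ s, IsMinOn φ s p := by
  obtain ⟨u, -, hlim, hu⟩ := exists_seq_tendsto_sInf (hne.image φ) hbdd
  choose x hx hxu using hu
  obtain rfl : (fun n => φ (x n)) = u := funext hxu
  have midpoint_le (k l : ℕ) :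
      m / 8 * ‖x k - x l‖ ^ 2 ≤ (φ (x k) + φ (x l)) / 2 - sInf (φ '' s) := by
    have hmid := hφ.2 (hx k) (hx l) (one_half_pos (α := ℝ)).le one_half_pos.le (add_halves 1)
    have hinf := csInf_le hbdd (mem_image_of_mem φ
      (hφ.1 (hx k) (hx l) (one_half_pos (α := ℝ)).le one_half_pos.le (add_halves 1)))
    simp only [smul_eq_mul] at hmid
    linarith
  have hcauchy : CauchySeq x := by
    refine Metric.cauchySeq_iff.2 fun ε hε => ?_
    obtain ⟨N, hN⟩ := eventually_atTop.1 (hlim.eventually_lt_const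
      (lt_add_of_pos_right (sInf (φ '' s)) (by positivity : 0 < m / 8 * ε ^ 2)))
    refine ⟨N, fun k hk l hl => ?_⟩
    rw [dist_eq_norm, ← sq_lt_sq₀ (norm_nonneg _) hε.le]
    exact lt_of_mul_lt_mul_left (by linarith [midpoint_le k l, hN k hk, hN l hl])
      (by positivity : 0 ≤ m / 8)
  obtain ⟨p, hp⟩ := cauchySeq_tendsto_of_complete hcauchy
  have hps : p ∈ s := hs.mem_of_tendsto hp (Eventually.of_forall hx)
  have hval : φ p = sInf (φ '' s) := tendsto_nhds_unique ((hcont p hps).tendsto.comp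
    (tendsto_nhdsWithin_iff.2 ⟨hp, Eventually.of_forall hx⟩)) hlim
  exact ⟨p, hps, fun w hw => hval.trans_le (csInf_le hbdd (mem_image_of_mem φ hw))⟩

end NormedSpace

variable {V : Type*} [NormedAddCommGroup V] [InnerProductSpace ℝ V] {h : V → ℝ} {ρ : ℝ}

theorem weaklyConvex_iff_strongConvexOn_neg : WeaklyConvex ρ h ↔ StrongConvexOn univ (-ρ) h := by
  rw [strongConvexOn_iff_convex, WeaklyConvex]
  simp only [neg_div, neg_mul, sub_neg_eq_add]

theorem strongConvexOn_add_sq_norm_sub (hh : WeaklyConvex ρ h) (c : ℝ) (x : V) :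
    StrongConvexOn univ (2 * c - ρ) fun w => h w + c * ‖w - x‖ ^ 2 := by
  have haffine : ConvexOn ℝ univ fun w : V => c * ‖x‖ ^ 2 - 2 * c * inner ℝ w x := by
    refine ⟨convex_univ, fun v _ w _ a b _ _ hab => le_of_eq ?_⟩
    simp only [inner_add_left, real_inner_smul_left, smul_eq_mul]
    linear_combination (-c * ‖x‖ ^ 2) * hab
  rw [strongConvexOn_iff_convex]
  refine (hh.add haffine).congr fun w _ => ?_
  simp only [Pi.add_apply, norm_sub_sq_real]
  ring

theorem le_on_segment_of_weaklyConvex (hh : WeaklyConvex ρ h) (z v : V) {t : ℝ}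
    (ht : t ∈ Icc (0 : ℝ) 1) :
    h (z + t • v) ≤ (1 - t) * h z + t * h (z + v) + ρ / 2 * ‖v‖ ^ 2 * (t * (1 - t)) := by
  have hle := (weaklyConvex_iff_strongConvexOn_neg.1 hh).2 (mem_univ z) (mem_univ (z + v))
    (sub_nonneg.2 ht.2) ht.1 (by ring)
  have hpoint : (1 - t) • z + t • (z + v) = z + t • v := by module
  simp only [smul_eq_mul, hpoint, sub_add_cancel_left, norm_neg] at hle
  linarith

end StrongConvexity

section Clarke

variable {V : Type*} [NormedAddCommGroup V] [InnerProductSpace ℝ V] {h : V → ℝ} {z g v : V}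

theorem inner_le_of_mem_clarkeSubdifferential (hg : g ∈ clarkeSubdifferential h z)
    {φ : V × ℝ → ℝ} (hφ : ContinuousAt φ (z, 0))
    (hle : ∀ᶠ p in 𝓝 z ×ˢ 𝓝[>] (0 : ℝ), h (p.1 + p.2 • v) - h p.1 ≤ p.2 * φ p) :
    inner ℝ g v ≤ φ (z, 0) := by
  have hlim : Tendsto (fun p => (φ p : EReal)) (𝓝 z ×ˢ 𝓝[>] (0 : ℝ)) (𝓝 (φ (z, 0) : EReal)) := by
    refine (continuous_coe_real_ereal.tendsto _).comp (hφ.tendsto.mono_left ?_)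
    rw [nhds_prod_eq]
    exact Filter.prod_mono le_rfl nhdsWithin_le_nhds
  have hderiv : clarkeDeriv h z v ≤ (φ (z, 0) : EReal) := by
    rw [← hlim.limsup_eq]
    refine limsup_le_limsup ?_
    filter_upwards [hle, tendsto_snd.eventually eventually_mem_nhdsWithin] with p hp hpos
    exact EReal.coe_le_coe_iff.2 ((div_le_iff₀' hpos).2 hp)
  exact EReal.coe_le_coe_iff.1 ((hg v).trans hderiv)

theorem norm_le_of_mem_clarkeSubdifferential {L : ℝ≥0} (hL : LipschitzWith L h)
    (hg : g ∈ clarkeSubdifferential h z) : ‖g‖ ≤ L := by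
  have hinner : inner ℝ g g ≤ L * ‖g‖ := by
    refine inner_le_of_mem_clarkeSubdifferential hg (φ := fun _ => L * ‖g‖) continuousAt_const ?_
    filter_upwards [tendsto_snd.eventually eventually_mem_nhdsWithin] with p (hp : 0 < p.2)
    calc h (p.1 + p.2 • g) - h p.1 ≤ L * dist (p.1 + p.2 • g) p.1 :=
          sub_le_iff_le_add'.2 (hL.le_add_mul _ _)
      _ = p.2 * (L * ‖g‖) := by
        rw [dist_self_add_left, norm_smul_of_nonneg hp.le]
        ring
  rw [real_inner_self_eq_norm_mul_norm] at hinner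
  exact (norm_nonneg g).eq_or_lt.elim (fun h0 => h0 ▸ L.2) fun hpos =>
    le_of_mul_le_mul_right hinner hpos

theorem inner_le_sub_add_of_le_on_segment (hcont : Continuous h) {c : ℝ}
    (hseg : ∀ z', ∀ t ∈ Icc (0 : ℝ) 1,
      h (z' + t • v) ≤ (1 - t) * h z' + t * h (z' + v) + c * (t * (1 - t)))
    (hg : g ∈ clarkeSubdifferential h z) : inner ℝ g v ≤ h (z + v) - h z + c := by
  have hle := inner_le_of_mem_clarkeSubdifferential hg (v := v)
    (φ := fun p => h (p.1 + v) - h p.1 + c * (1 - p.2)) (by fun_prop) ?_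
  · simpa using hle
  · filter_upwards [tendsto_snd.eventually (Ioc_mem_nhdsGT zero_lt_one)] with p hp
    linarith [hseg p.1 p.2 (Ioc_subset_Icc_self hp)]

-- The quotients in direction `-v` are bounded by the concave secant on `[p.1 - p.2 • v, p.1 + v]`.
theorem sub_le_inner_of_le_on_segment (hcont : Continuous h)
    (hseg : ∀ z', ∀ t ∈ Icc (0 : ℝ) 1, (1 - t) * h z' + t * h (z' + v) ≤ h (z' + t • v))
    (hg : g ∈ clarkeSubdifferential h z) : h (z + v) - h z ≤ inner ℝ g v := by
  have hle := inner_le_of_mem_clarkeSubdifferential hg (v := -v)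
    (φ := fun p => h (p.1 - p.2 • v) - h (p.1 - p.2 • v + v)) (by fun_prop) ?_
  · simp only [inner_neg_right, zero_smul, sub_zero] at hle
    linarith
  · filter_upwards [tendsto_snd.eventually (Ioc_mem_nhdsGT zero_lt_one)] with p hp
    have := hseg (p.1 - p.2 • v) p.2 (Ioc_subset_Icc_self hp)
    rw [sub_add_cancel] at this
    rw [smul_neg, ← sub_eq_add_neg]
    linarith

variable {E F : Type*} [NormedAddCommGroup E] [InnerProductSpace ℝ E]
  [NormedAddCommGroup F] [InnerProductSpace ℝ F] {f : E → F → ℝ} {x : E} {y : F}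
  {γ : WithLp 2 (E × F)}

theorem inner_fst_le_of_mem_subdiff {ρ : ℝ} (hf : Continuous (joint f))
    (hconv : ∀ y, WeaklyConvex ρ fun x => f x y) (hγ : γ ∈ subdiff f x y) (w : E) :
    inner ℝ γ.fst (w - x) ≤ f w y - f x y + ρ / 2 * ‖w - x‖ ^ 2 := by
  have hle := inner_le_sub_add_of_le_on_segment (v := WithLp.toLp 2 (w - x, 0)) hf
    (fun z t ht => by
      simpa [joint] using le_on_segment_of_weaklyConvex (hconv z.snd) z.fst (w - x) ht) hγ
  simpa [joint, WithLp.prod_inner_apply] using hle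

theorem sub_le_inner_snd_of_mem_subdiff (hf : Continuous (joint f))
    (hconc : ∀ x, ConcaveOn ℝ univ (f x)) (hγ : γ ∈ subdiff f x y) (w : F) :
    f x w - f x y ≤ inner ℝ γ.snd (w - y) := by
  have hle := sub_le_inner_of_le_on_segment (v := WithLp.toLp 2 (0, w - y)) hf
    (fun z t ht => by
      have hpoint : (1 - t) • z.snd + t • (z.snd + (w - y)) = z.snd + t • (w - y) := by module
      simpa [joint, hpoint, -smul_add] using (hconc z.fst).2 (mem_univ z.snd)
        (mem_univ (z.snd + (w - y))) (sub_nonneg.2 ht.2) ht.1 (by ring)) hγ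
  simpa [joint, WithLp.prod_inner_apply] using hle

end Clarke

section Primal

variable {E F : Type*} {f : E → F → ℝ} {Y : Set F}

theorem primal_le (hne : Y.Nonempty) {x : E} {c : ℝ} (h : ∀ y ∈ Y, f x y ≤ c) :
    primal f Y x ≤ c :=
  have := hne.to_subtype
  ciSup_le fun y => h y y.2

/-- The suboptimality `Φ(x) - f(x, y)` of `y` in the inner problem `max_{y ∈ Y} f(x, y)`. -/
noncomputable def dualGap (f : E → F → ℝ) (Y : Set F) (x : E) (y : F) : ℝ := primal f Y x - f x y

variable [NormedAddCommGroup E] [NormedAddCommGroup F] {L : ℝ≥0} {ρ D : ℝ}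

theorem lipschitzWith_left_of_joint (hf : LipschitzWith L (joint f)) (y : F) :
    LipschitzWith L fun x => f x y := by
  refine LipschitzWith.of_dist_le_mul fun x x' => ?_
  simpa [joint, WithLp.prod_dist_eq_of_L2] using
    hf.dist_le_mul (WithLp.toLp 2 (x, y)) (WithLp.toLp 2 (x', y))

theorem lipschitzWith_right_of_joint (hf : LipschitzWith L (joint f)) (x : E) :
    LipschitzWith L (f x) := by
  refine LipschitzWith.of_dist_le_mul fun y y' => ?_
  simpa [joint, WithLp.prod_dist_eq_of_L2] using
    hf.dist_le_mul (WithLp.toLp 2 (x, y)) (WithLp.toLp 2 (x, y'))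

variable [InnerProductSpace ℝ E] [InnerProductSpace ℝ F]

namespace IsNonconvexConcave

variable (hf : IsNonconvexConcave f Y L ρ D) {y y' : F}
include hf

theorem dist_le (hy : y ∈ Y) (hy' : y' ∈ Y) : dist y y' ≤ D :=
  (Metric.dist_le_diam_of_mem hf.bounded hy hy').trans hf.diam_le

theorem le_add_mul_diam (x : E) (hy : y ∈ Y) (hy' : y' ∈ Y) : f x y ≤ f x y' + L * D :=
  ((lipschitzWith_right_of_joint hf.lipschitz x).le_add_mul y y').trans
    (by gcongr; exact hf.dist_le hy hy')

theorem le_primal (x : E) (hy : y ∈ Y) : f x y ≤ primal f Y x :=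
  le_ciSup (f := fun y : Y => f x y)
    ⟨f x y + L * D, forall_mem_range.2 fun y' => hf.le_add_mul_diam x y'.2 hy⟩ ⟨y, hy⟩

theorem dualGap_nonneg (x : E) (hy : y ∈ Y) : 0 ≤ dualGap f Y x y :=
  sub_nonneg.2 (hf.le_primal x hy)

theorem dualGap_le (x : E) (hy : y ∈ Y) : dualGap f Y x y ≤ L * D :=
  sub_le_iff_le_add'.2 (primal_le ⟨y, hy⟩ fun _ hy' => hf.le_add_mul_diam x hy' hy)

theorem lipschitzWith_primal (hne : Y.Nonempty) : LipschitzWith L (primal f Y) := by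
  refine LipschitzWith.of_le_add_mul L fun x x' => primal_le hne fun y hy => ?_
  linarith [(lipschitzWith_left_of_joint hf.lipschitz y).le_add_mul x x', hf.le_primal x' hy]

theorem continuous_dualGap (hne : Y.Nonempty) :
    Continuous fun p : E × F => dualGap f Y p.1 p.2 := by
  have hjoint : Continuous fun p : E × F => joint f (WithLp.toLp 2 p) :=
    hf.lipschitz.continuous.comp (WithLp.prod_continuous_toLp 2 E F)
  exact ((hf.lipschitzWith_primal hne).continuous.comp continuous_fst).sub hjoint

theorem weaklyConvex_primal (hne : Y.Nonempty) : WeaklyConvex ρ (primal f Y) := by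
  refine ⟨convex_univ, fun x _ x' _ a b ha hb hab => le_sub_iff_add_le.1 ?_⟩
  refine primal_le hne fun y hy => le_sub_iff_add_le.2 ?_
  refine ((hf.weaklyConvex y).2 (mem_univ x) (mem_univ x') ha hb hab).trans ?_
  simp only [smul_eq_mul]
  gcongr <;> exact hf.le_primal _ hy

end IsNonconvexConcave

end Primal

section Projection

variable {V : Type*} [NormedAddCommGroup V] [InnerProductSpace ℝ V] [CompleteSpace V] {Y : Set V}
  (hne : Y.Nonempty) (hcl : IsClosed Y) (hco : Convex ℝ Y)
include hne hcl hco

theorem inner_sub_proj_le_zero (z : V) {q : V} (hq : q ∈ Y) :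
    inner ℝ (z - proj Y z) (q - proj Y z) ≤ 0 := by
  obtain ⟨hmem, hle⟩ := proj_spec hne hcl hco z
  have := hne.to_subtype
  refine (norm_eq_iInf_iff_real_inner_le_zero hco hmem).1 (le_antisymm ?_ ?_) q hq
  · exact le_ciInf fun w => hle w w.2
  · exact ciInf_le ⟨0, forall_mem_range.2 fun _ => norm_nonneg _⟩ (⟨_, hmem⟩ : Y)

theorem lipschitzWith_proj : LipschitzWith 1 (proj Y) := by
  refine LipschitzWith.of_dist_le_mul fun z z' => ?_
  rw [dist_eq_norm, dist_eq_norm, NNReal.coe_one, one_mul]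
  have hz := inner_sub_proj_le_zero hne hcl hco z (proj_spec hne hcl hco z').1
  have hz' := inner_sub_proj_le_zero hne hcl hco z' (proj_spec hne hcl hco z).1
  have firmly_nonexpansive : ‖proj Y z - proj Y z'‖ * ‖proj Y z - proj Y z'‖
      ≤ inner ℝ (z - z') (proj Y z - proj Y z') := by
    rw [← real_inner_self_eq_norm_mul_norm]
    simp only [inner_sub_left, inner_sub_right] at hz hz' ⊢
    linarith
  rcases (norm_nonneg (proj Y z - proj Y z')).eq_or_lt with h0 | hpos
  · exact h0 ▸ norm_nonneg _
  · exact le_of_mul_le_mul_right (firmly_nonexpansive.trans (real_inner_le_norm _ _)) hpos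

theorem norm_proj_sub_le (z : V) {q : V} (hq : q ∈ Y) : ‖proj Y z - q‖ ≤ ‖z - q‖ := by
  have hfix : q = proj Y q := proj_unique hne hcl hco q q hq fun w _ => by simp
  simpa [← hfix, dist_eq_norm] using (lipschitzWith_proj hne hcl hco).dist_le_mul z q

theorem norm_proj_add_smul_sub_sq_le (η : ℝ) (y u : V) {w : V} (hw : w ∈ Y) :
    ‖proj Y (y + η • u) - w‖ ^ 2
      ≤ ‖y - w‖ ^ 2 + η ^ 2 * ‖u‖ ^ 2 - 2 * η * inner ℝ u (w - y) := by
  calc ‖proj Y (y + η • u) - w‖ ^ 2 ≤ ‖y - w + η • u‖ ^ 2 := by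
        rw [sub_add_eq_add_sub]
        gcongr
        exact norm_proj_sub_le hne hcl hco _ hw
    _ = ‖y - w‖ ^ 2 + η ^ 2 * ‖u‖ ^ 2 - 2 * η * inner ℝ u (w - y) := by
        rw [norm_add_sq_real, norm_smul, mul_pow, Real.norm_eq_abs, sq_abs, real_inner_smul_right,
          real_inner_comm, ← neg_sub w y, inner_neg_right, norm_neg]
        ring

end Projection

section Moreau

variable {V : Type*} [NormedAddCommGroup V] {h : V → ℝ} {ρ : ℝ}

theorem moreauEnvelope_one_div_two_mul (h : V → ℝ) (ρ : ℝ) (x : V) :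
    moreauEnvelope h (1 / (2 * ρ)) x = ⨅ w, (h w + ρ * ‖w - x‖ ^ 2) := by
  have hcoeff : 1 / (2 * (1 / (2 * ρ))) = ρ := by
    rw [one_div (2 * ρ), mul_inv, mul_inv_cancel_left₀ two_ne_zero, one_div, inv_inv]
  simp only [moreauEnvelope, hcoeff]

variable [InnerProductSpace ℝ V]

/-- The standing assumptions under which the proximal map of `h` with parameter `1 / (2 * ρ)` is
single valued and the Moreau envelope `h_{1/(2ρ)}` is differentiable. -/
structure MoreauRegular (h : V → ℝ) (ρ : ℝ) : Prop where
  pos : 0 < ρ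
  weaklyConvex : WeaklyConvex ρ h
  continuous : Continuous h
  bddBelow : BddBelow (range h)

/-- The proximal map: a minimizer of `w ↦ h w + ρ * ‖w - x‖ ^ 2`, which exists by
`MoreauRegular.prox_le`; otherwise a junk value. -/
noncomputable def prox (h : V → ℝ) (ρ : ℝ) (x : V) : V :=
  Classical.epsilon fun p => ∀ w, h p + ρ * ‖p - x‖ ^ 2 ≤ h w + ρ * ‖w - x‖ ^ 2

/-- The gradient of the Moreau envelope `h_{1/(2ρ)}`. -/
noncomputable def moreauGrad [CompleteSpace V] (h : V → ℝ) (ρ : ℝ) : V → V :=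
  gradient (moreauEnvelope h (1 / (2 * ρ)))

namespace MoreauRegular

variable (hh : MoreauRegular h ρ)
include hh

theorem strongConvexOn_add_sq (x : V) :
    StrongConvexOn univ ρ fun w => h w + ρ * ‖w - x‖ ^ 2 := by
  simpa [two_mul] using strongConvexOn_add_sq_norm_sub hh.weaklyConvex ρ x

variable [CompleteSpace V]

theorem prox_le (x w : V) :
    h (prox h ρ x) + ρ * ‖prox h ρ x - x‖ ^ 2 ≤ h w + ρ * ‖w - x‖ ^ 2 := by
  obtain ⟨b, hb⟩ := hh.bddBelow
  have hcont := hh.continuous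
  obtain ⟨p, -, hp⟩ := exists_isMinOn_of_strongConvexOn (hh.strongConvexOn_add_sq x) hh.pos
    isClosed_univ univ_nonempty (by fun_prop) ⟨b, forall_mem_image.2 fun w _ =>
      (hb (mem_range_self w)).trans
        (le_add_of_nonneg_right (mul_nonneg hh.pos.le (sq_nonneg _)))⟩
  exact Classical.epsilon_spec
    (p := fun p => ∀ w, h p + ρ * ‖p - x‖ ^ 2 ≤ h w + ρ * ‖w - x‖ ^ 2)
    ⟨p, fun w => hp (mem_univ w)⟩ w

theorem prox_add_sq_le (x w : V) :
    h (prox h ρ x) + ρ * ‖prox h ρ x - x‖ ^ 2 + ρ / 2 * ‖w - prox h ρ x‖ ^ 2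
      ≤ h w + ρ * ‖w - x‖ ^ 2 :=
  add_sq_norm_sub_le_of_isMinOn_of_strongConvexOn (hh.strongConvexOn_add_sq x) (mem_univ _)
    (fun v _ => hh.prox_le x v) (mem_univ w)

theorem prox_add_sq_le_self (x : V) :
    h (prox h ρ x) + 3 / 2 * ρ * ‖prox h ρ x - x‖ ^ 2 ≤ h x := by
  have hle := hh.prox_add_sq_le x x
  rw [sub_self, norm_zero, norm_sub_rev x] at hle
  linarith

theorem moreauEnvelope_eq (x : V) : moreauEnvelope h (1 / (2 * ρ)) x
    = h (prox h ρ x) + ρ * ‖prox h ρ x - x‖ ^ 2 := by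
  rw [moreauEnvelope_one_div_two_mul]
  exact le_antisymm
    (ciInf_le (f := fun w => h w + ρ * ‖w - x‖ ^ 2) ⟨_, forall_mem_range.2 (hh.prox_le x)⟩ _)
    (le_ciInf (hh.prox_le x))

theorem moreauEnvelope_le_add (x w : V) :
    moreauEnvelope h (1 / (2 * ρ)) x ≤ h w + ρ * ‖w - x‖ ^ 2 :=
  (hh.moreauEnvelope_eq x).trans_le (hh.prox_le x w)

theorem moreauEnvelope_le (x : V) : moreauEnvelope h (1 / (2 * ρ)) x ≤ h x := by
  simpa using hh.moreauEnvelope_le_add x x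

theorem lipschitzWith_prox : LipschitzWith 2 (prox h ρ) := by
  refine LipschitzWith.of_dist_le_mul fun x x' => ?_
  have hx := hh.prox_add_sq_le x (prox h ρ x')
  have hx' := hh.prox_add_sq_le x' (prox h ρ x)
  rw [dist_eq_norm, dist_eq_norm, NNReal.coe_ofNat]
  set p := prox h ρ x
  set p' := prox h ρ x'
  have polarization : ‖p' - x‖ ^ 2 - ‖p - x‖ ^ 2 + (‖p - x'‖ ^ 2 - ‖p' - x'‖ ^ 2)
      = 2 * inner ℝ (x - x') (p - p') := by
    simp only [norm_sub_sq_real, inner_sub_left, inner_sub_right, real_inner_comm x,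
      real_inner_comm x']
    ring
  have monotone : ‖p - p'‖ * ‖p - p'‖ ≤ 2 * inner ℝ (x - x') (p - p') := by
    refine le_of_mul_le_mul_left ?_ hh.pos
    rw [← polarization]
    rw [norm_sub_rev p'] at hx
    linarith
  rcases (norm_nonneg (p - p')).eq_or_lt with h0 | hpos
  · exact h0 ▸ by positivity
  · exact le_of_mul_le_mul_right
      (by linarith [real_inner_le_norm (x - x') (p - p')]) hpos

theorem moreauEnvelope_le_add_inner_prox (x x' : V) :
    moreauEnvelope h (1 / (2 * ρ)) x' ≤ moreauEnvelope h (1 / (2 * ρ)) x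
      + inner ℝ ((2 * ρ) • (x - prox h ρ x)) (x' - x) + ρ * ‖x' - x‖ ^ 2 := by
  have hle := hh.moreauEnvelope_le_add x' (prox h ρ x)
  have hsplit : prox h ρ x - x' = -((x - prox h ρ x) + (x' - x)) := by abel
  rw [hsplit, norm_neg, norm_add_sq_real, norm_sub_rev x] at hle
  rw [hh.moreauEnvelope_eq x, real_inner_smul_left]
  linarith

theorem add_inner_prox_le_moreauEnvelope (x x' : V) :
    moreauEnvelope h (1 / (2 * ρ)) x + inner ℝ ((2 * ρ) • (x - prox h ρ x)) (x' - x)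
      - 3 * ρ * ‖x' - x‖ ^ 2 ≤ moreauEnvelope h (1 / (2 * ρ)) x' := by
  have hle := hh.moreauEnvelope_le_add_inner_prox x' x
  have hsplit : inner ℝ (x' - prox h ρ x') (x - x') = -inner ℝ (x - prox h ρ x) (x' - x)
      - ‖x' - x‖ ^ 2 + inner ℝ (prox h ρ x' - prox h ρ x) (x' - x) := by
    rw [← real_inner_self_eq_norm_sq, ← inner_neg_left, ← inner_sub_left, ← inner_add_left,
      ← neg_sub x' x, inner_neg_right, ← inner_neg_left]
    congr 1
    abel
  have hcross : inner ℝ (prox h ρ x' - prox h ρ x) (x' - x) ≤ 2 * ‖x' - x‖ ^ 2 := by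
    have hlip := hh.lipschitzWith_prox.dist_le_mul x' x
    rw [dist_eq_norm, dist_eq_norm, NNReal.coe_ofNat] at hlip
    calc inner ℝ (prox h ρ x' - prox h ρ x) (x' - x)
        ≤ ‖prox h ρ x' - prox h ρ x‖ * ‖x' - x‖ := real_inner_le_norm _ _
      _ ≤ 2 * ‖x' - x‖ * ‖x' - x‖ := by gcongr
      _ = 2 * ‖x' - x‖ ^ 2 := by ring
  rw [real_inner_smul_left, norm_sub_rev x, hsplit] at hle
  rw [real_inner_smul_left]
  linarith [mul_le_mul_of_nonneg_left hcross (mul_pos two_pos hh.pos).le]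

theorem hasGradientAt_moreauEnvelope (x : V) :
    HasGradientAt (moreauEnvelope h (1 / (2 * ρ))) ((2 * ρ) • (x - prox h ρ x)) x := by
  rw [hasGradientAt_iff_isLittleO]
  refine Asymptotics.IsBigO.trans_isLittleO (g := fun x' => ‖x' - x‖ ^ 2)
    (Asymptotics.IsBigO.of_bound (3 * ρ) (Eventually.of_forall fun x' => ?_)) ?_
  · have := mul_nonneg hh.pos.le (sq_nonneg ‖x' - x‖)
    rw [Real.norm_of_nonneg (sq_nonneg ‖x' - x‖), Real.norm_eq_abs, abs_le]
    constructor
    · linarith [hh.add_inner_prox_le_moreauEnvelope x x']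
    · linarith [hh.moreauEnvelope_le_add_inner_prox x x']
  · refine (Asymptotics.isLittleO_norm_pow_id one_lt_two).comp_tendsto ?_
    exact tendsto_sub_nhds_zero_iff.2 tendsto_id

theorem moreauGrad_eq (x : V) : moreauGrad h ρ x = (2 * ρ) • (x - prox h ρ x) :=
  (hh.hasGradientAt_moreauEnvelope x).gradient

theorem differentiable_moreauEnvelope : Differentiable ℝ (moreauEnvelope h (1 / (2 * ρ))) :=
  fun x => (hh.hasGradientAt_moreauEnvelope x).differentiableAt

theorem continuous_moreauGrad : Continuous (moreauGrad h ρ) := by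
  have hprox := hh.lipschitzWith_prox.continuous
  rw [show moreauGrad h ρ = _ from funext hh.moreauGrad_eq]
  fun_prop

theorem moreauEnvelope_le_add_inner (x x' : V) :
    moreauEnvelope h (1 / (2 * ρ)) x' ≤ moreauEnvelope h (1 / (2 * ρ)) x
      + inner ℝ (moreauGrad h ρ x) (x' - x) + ρ * ‖x' - x‖ ^ 2 :=
  hh.moreauGrad_eq x ▸ hh.moreauEnvelope_le_add_inner_prox x x'

theorem sq_norm_moreauGrad (x : V) :
    ‖moreauGrad h ρ x‖ ^ 2 = 4 * ρ * (ρ * ‖prox h ρ x - x‖ ^ 2) := by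
  rw [hh.moreauGrad_eq, norm_smul, mul_pow, norm_sub_rev, Real.norm_eq_abs, sq_abs]
  ring

theorem sq_norm_moreauGrad_le (x : V) :
    ‖moreauGrad h ρ x‖ ^ 2 ≤ 4 * ρ * (moreauEnvelope h (1 / (2 * ρ)) x - ⨅ w, h w) := by
  rw [hh.sq_norm_moreauGrad, hh.moreauEnvelope_eq]
  have := hh.pos
  gcongr
  linarith [ciInf_le hh.bddBelow (prox h ρ x)]

theorem iInf_le_moreauEnvelope (x : V) : ⨅ w, h w ≤ moreauEnvelope h (1 / (2 * ρ)) x := by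
  rw [hh.moreauEnvelope_eq]
  have := mul_nonneg hh.pos.le (sq_nonneg ‖prox h ρ x - x‖)
  linarith [ciInf_le hh.bddBelow (prox h ρ x)]

theorem norm_moreauGrad_le {L : ℝ≥0} (hL : LipschitzWith L h) (x : V) :
    ‖moreauGrad h ρ x‖ ≤ 2 * L := by
  have := hh.pos
  set d := ‖prox h ρ x - x‖ with hd
  have hnorm : ‖moreauGrad h ρ x‖ = 2 * (ρ * d) := by
    rw [hh.moreauGrad_eq, norm_smul_of_nonneg (by positivity), norm_sub_rev, mul_assoc]
  have hle : ρ * d * d ≤ L * d := by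
    have hdrop := hL.le_add_mul x (prox h ρ x)
    rw [dist_comm, dist_eq_norm, ← hd] at hdrop
    have := mul_nonneg hh.pos.le (sq_nonneg d)
    linarith [hh.prox_add_sq_le_self x]
  rw [hnorm]
  gcongr
  rcases (norm_nonneg (prox h ρ x - x)).eq_or_lt with h0 | hpos
  · rw [hd, ← h0, mul_zero]
    exact L.2
  · exact le_of_mul_le_mul_right hle hpos

end MoreauRegular

end Moreau

section WellPosed

variable {E F : Type*} [NormedAddCommGroup E] [InnerProductSpace ℝ E]
  [NormedAddCommGroup F] [InnerProductSpace ℝ F] {f : E → F → ℝ} {L : ℝ≥0} {Y : Set F} {ρ D : ℝ}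

/-- The problem class of the convergence analysis: the inner problem is feasible, the weak convexity
modulus is positive and `Φ` is bounded below. -/
structure IsWellPosed (f : E → F → ℝ) (Y : Set F) (L : ℝ≥0) (ρ D : ℝ) : Prop
    extends IsNonconvexConcave f Y L ρ D where
  nonempty : Y.Nonempty
  pos : 0 < ρ
  bddBelow : BddBelow (range (primal f Y))

namespace IsWellPosed

variable (hf : IsWellPosed f Y L ρ D)
include hf

theorem moreauRegular : MoreauRegular (primal f Y) ρ :=
  ⟨hf.pos, hf.weaklyConvex_primal hf.nonempty, (hf.lipschitzWith_primal hf.nonempty).continuous,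
    hf.bddBelow⟩

theorem gap_nonneg (x₀ : E) : 0 ≤ gap f Y x₀ :=
  sub_nonneg.2 (ciInf_le hf.bddBelow x₀)

theorem half_sq_norm_moreauGrad_le_inner_fst [CompleteSpace E] {x : E} {y : F} (hy : y ∈ Y)
    {g : WithLp 2 (E × F)} (hg : g ∈ subdiff f x y) :
    ‖moreauGrad (primal f Y) ρ x‖ ^ 2 / 2 - 2 * ρ * dualGap f Y x y
      ≤ inner ℝ g.fst (moreauGrad (primal f Y) ρ x) := by
  have hprox := hf.moreauRegular.prox_add_sq_le_self x
  have hsub := inner_fst_le_of_mem_subdiff hf.lipschitz.continuous hf.weaklyConvex hg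
    (prox (primal f Y) ρ x)
  rw [hf.moreauRegular.sq_norm_moreauGrad, hf.moreauRegular.moreauGrad_eq, dualGap,
    real_inner_smul_right, ← neg_sub (prox _ _ x) x, inner_neg_right]
  have hle := mul_le_mul_of_nonneg_left (hsub.trans
    (by linarith [hf.le_primal (prox (primal f Y) ρ x) hy] : _ ≤ primal f Y x - f x y
      - ρ * ‖prox (primal f Y) ρ x - x‖ ^ 2)) (mul_pos two_pos hf.pos).le
  linarith

end IsWellPosed

end WellPosed

section ConditionalExpectation

variable {V Ω : Type*} [NormedAddCommGroup V] {m mΩ : MeasurableSpace Ω} {μ : Measure Ω}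

theorem integral_norm_le_sqrt [IsProbabilityMeasure μ] {u : Ω → V} (hu : MemLp u 2 μ) {S : ℝ}
    (hS : ∫ ω, ‖u ω‖ ^ 2 ∂μ ≤ S) : ∫ ω, ‖u ω‖ ∂μ ≤ √S := by
  refine Real.le_sqrt_of_sq_le ?_
  have hvar := variance_eq_sub hu.norm
  have hnonneg := variance_nonneg (fun ω => ‖u ω‖) μ
  simp only [Pi.pow_apply] at hvar
  linarith

variable [InnerProductSpace ℝ V]

theorem integrable_inner_of_norm_le {u w : Ω → V} (hu : Integrable u μ)
    (hw : AEStronglyMeasurable w μ) {c : ℝ} (hc : ∀ ω, ‖w ω‖ ≤ c) :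
    Integrable (fun ω => inner ℝ (u ω) (w ω)) μ :=
  (hu.norm.mul_const c).mono' (hu.1.inner hw) <| ae_of_all _ fun ω =>
    (norm_inner_le_norm _ _).trans (mul_le_mul_of_nonneg_left (hc ω) (norm_nonneg _))

theorem integral_inner_condExp [CompleteSpace V] [IsFiniteMeasure μ] (hm : m ≤ mΩ) {u w : Ω → V}
    (hu : Integrable u μ) (hw : StronglyMeasurable[m] w) {c : ℝ} (hc : ∀ ω, ‖w ω‖ ≤ c) :
    ∫ ω, inner ℝ (μ[u|m] ω) (w ω) ∂μ = ∫ ω, inner ℝ (u ω) (w ω) ∂μ := by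
  have hint := integrable_inner_of_norm_le hu (hw.mono hm).aestronglyMeasurable hc
  rw [← integral_condExp hm (f := fun ω => inner ℝ (u ω) (w ω))]
  exact integral_congr_ae
    (condExp_bilin_of_stronglyMeasurable_right (innerSL ℝ) hw hint hu).symm

variable {E F : Type*} [NormedAddCommGroup E] [InnerProductSpace ℝ E] [CompleteSpace E]
  [NormedAddCommGroup F] [InnerProductSpace ℝ F] [CompleteSpace F] [IsFiniteMeasure μ]
  {g : Ω → WithLp 2 (E × F)}

theorem integral_inner_fst_condExp (hm : m ≤ mΩ) (hg : Integrable g μ) {w : Ω → E}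
    (hw : StronglyMeasurable[m] w) {c : ℝ} (hc : ∀ ω, ‖w ω‖ ≤ c) :
    ∫ ω, inner ℝ (μ[g|m] ω).fst (w ω) ∂μ = ∫ ω, inner ℝ (g ω).fst (w ω) ∂μ := by
  have hmeas : StronglyMeasurable[m] fun ω => WithLp.toLp 2 (w ω, (0 : F)) :=
    (WithLp.prod_continuous_toLp 2 E F).comp_stronglyMeasurable
      (hw.prodMk stronglyMeasurable_const)
  simpa [WithLp.prod_inner_apply] using
    integral_inner_condExp hm hg hmeas fun ω => by simpa using hc ω

theorem integral_inner_snd_condExp (hm : m ≤ mΩ) (hg : Integrable g μ) {w : Ω → F}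
    (hw : StronglyMeasurable[m] w) {c : ℝ} (hc : ∀ ω, ‖w ω‖ ≤ c) :
    ∫ ω, inner ℝ (μ[g|m] ω).snd (w ω) ∂μ = ∫ ω, inner ℝ (g ω).snd (w ω) ∂μ := by
  have hmeas : StronglyMeasurable[m] fun ω => WithLp.toLp 2 ((0 : E), w ω) :=
    (WithLp.prod_continuous_toLp 2 E F).comp_stronglyMeasurable
      (stronglyMeasurable_const.prodMk hw)
  simpa [WithLp.prod_inner_apply] using
    integral_inner_condExp hm hg hmeas fun ω => by simpa using hc ω

end ConditionalExpectation

section Expectations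

variable {E F Ω : Type*} [NormedAddCommGroup E] [InnerProductSpace ℝ E] [NormedAddCommGroup F]
  [InnerProductSpace ℝ F] {m mΩ : MeasurableSpace Ω} {μ : Measure Ω} [IsFiniteMeasure μ]
  {f : E → F → ℝ} {Y : Set F} {L : ℝ≥0} {ρ D : ℝ} {X : Ω → E} {y w : Ω → F}

namespace IsNonconvexConcave

variable (hf : IsNonconvexConcave f Y L ρ D)
include hf

theorem dualGap_le_dualGap_add (x x' : E) {y : F} (hy : y ∈ Y) :
    dualGap f Y x y ≤ dualGap f Y x' y + 2 * L * ‖x - x'‖ := by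
  have hprimal := (hf.lipschitzWith_primal ⟨y, hy⟩).le_add_mul x x'
  have hleft := (lipschitzWith_left_of_joint hf.lipschitz y).le_add_mul x' x
  rw [dist_eq_norm] at hprimal
  rw [dist_comm, dist_eq_norm] at hleft
  rw [dualGap, dualGap]
  linarith

theorem integrable_dualGap (hX : AEStronglyMeasurable X μ) (hy : AEStronglyMeasurable y μ)
    (hyY : ∀ ω, y ω ∈ Y) : Integrable (fun ω => dualGap f Y (X ω) (y ω)) μ := by
  rcases isEmpty_or_nonempty Ω with hΩ | ⟨⟨ω₀⟩⟩
  · exact .of_isEmpty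
  refine .of_bound ((hf.continuous_dualGap ⟨_, hyY ω₀⟩).comp_aestronglyMeasurable
    (hX.prodMk hy)) (L * D) <| ae_of_all _ fun ω => ?_
  rw [Real.norm_of_nonneg (hf.dualGap_nonneg _ (hyY ω))]
  exact hf.dualGap_le _ (hyY ω)

theorem sq_norm_sub_le {y y' : F} (hy : y ∈ Y) (hy' : y' ∈ Y) : ‖y - y'‖ ^ 2 ≤ D ^ 2 :=
  pow_le_pow_left₀ (norm_nonneg _) (dist_eq_norm y y' ▸ hf.dist_le hy hy') 2

theorem integrable_sq_norm_sub (hy : AEStronglyMeasurable y μ) (hyY : ∀ ω, y ω ∈ Y)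
    (hw : AEStronglyMeasurable w μ) (hwY : ∀ ω, w ω ∈ Y) :
    Integrable (fun ω => ‖y ω - w ω‖ ^ 2) μ :=
  .of_bound ((hy.sub hw).norm.pow 2) (D ^ 2) <| ae_of_all _ fun ω => by
    simpa using hf.sq_norm_sub_le (hyY ω) (hwY ω)

theorem exists_stronglyMeasurable_dualGap_le [SecondCountableTopology F] (hne : Y.Nonempty)
    (hX : StronglyMeasurable[m] X) {δ : ℝ} (hδ : 0 < δ) :
    ∃ w : Ω → F, StronglyMeasurable[m] w ∧ (∀ ω, w ω ∈ Y) ∧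
      ∀ ω, dualGap f Y (X ω) (w ω) ≤ δ := by
  classical
  have : Nonempty Y := hne.to_subtype
  let d := TopologicalSpace.denseSeq Y
  have hex ω : ∃ k, dualGap f Y (X ω) (d k) < δ := by
    have hcont : Continuous fun y : Y => dualGap f Y (X ω) y :=
      (hf.continuous_dualGap hne).comp (by fun_prop : Continuous fun y : Y => (X ω, (y : F)))
    obtain ⟨y, hy⟩ := exists_lt_of_lt_ciSup (sub_lt_self (primal f Y (X ω)) hδ)
    exact (TopologicalSpace.denseRange_denseSeq Y).exists_mem_open
      (isOpen_lt hcont continuous_const) ⟨y, sub_lt_comm.1 hy⟩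
  have hfind : Measurable[m] fun ω => Nat.find (hex ω) := measurable_find hex fun k =>
    measurableSet_lt ((hf.continuous_dualGap hne).comp_stronglyMeasurable
      (hX.prodMk stronglyMeasurable_const)).measurable measurable_const
  exact ⟨fun ω => d (Nat.find (hex ω)),
    (StronglyMeasurable.of_discrete (f := fun k => (d k : F))).comp_measurable hfind,
    fun ω => (d _).2, fun ω => (Nat.find_spec (hex ω)).le⟩

end IsNonconvexConcave

theorem MoreauRegular.integrable_sq_norm_moreauGrad [CompleteSpace E] {h : E → ℝ}
    (hh : MoreauRegular h ρ) (hL : LipschitzWith L h) (hX : AEStronglyMeasurable X μ) :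
    Integrable (fun ω => ‖moreauGrad h ρ (X ω)‖ ^ 2) μ :=
  .of_bound ((hh.continuous_moreauGrad.comp_aestronglyMeasurable hX).norm.pow 2) ((2 * L) ^ 2) <|
    ae_of_all _ fun ω => by
      simpa using pow_le_pow_left₀ (norm_nonneg _) (hh.norm_moreauGrad_le hL (X ω)) 2

theorem MoreauRegular.integrable_moreauEnvelope [CompleteSpace E] {h : E → ℝ}
    (hh : MoreauRegular h ρ) (hL : LipschitzWith L h) (hX : Integrable X μ) :
    Integrable (fun ω => moreauEnvelope h (1 / (2 * ρ)) (X ω)) μ := by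
  refine integrable_of_le_of_le
    (hh.differentiable_moreauEnvelope.continuous.comp_aestronglyMeasurable hX.1)
    (ae_of_all _ fun ω => hh.iInf_le_moreauEnvelope (X ω))
    (ae_of_all _ fun ω => (hh.moreauEnvelope_le (X ω)).trans (hL.le_add_mul (X ω) 0))
    (integrable_const _) ?_
  simp only [dist_zero_right]
  exact (integrable_const _).add (hX.norm.const_mul _)

end Expectations

section NoisyRun

variable {E F Ω : Type*} [NormedAddCommGroup E] [InnerProductSpace ℝ E]
  [NormedAddCommGroup F] [InnerProductSpace ℝ F] {mΩ : MeasurableSpace Ω}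

/-- `T` steps of descent ascent along random directions `g t` with second moment at most `S`, whose
conditional expectation given the past `ℱ t` is a Clarke subgradient at the current iterate. It
covers both methods: for the deterministic one `Ω` is a point and `g t` is the subgradient. -/
structure IsNoisyRun (μ : Measure Ω) (ℱ : Filtration ℕ mΩ) (f : E → F → ℝ) (Y : Set F)
    (ηx ηy S : ℝ) (x₀ : E) (T : ℕ) (x : ℕ → Ω → E) (y : ℕ → Ω → F)
    (g : ℕ → Ω → WithLp 2 (E × F)) : Prop where
  init_x : ∀ ω, x 0 ω = x₀
  stronglyMeasurable_x : ∀ t ≤ T, StronglyMeasurable[ℱ t] (x t)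
  stronglyMeasurable_y : ∀ t ≤ T, StronglyMeasurable[ℱ t] (y t)
  mem_y : ∀ t ≤ T, ∀ ω, y t ω ∈ Y
  memLp : ∀ t < T, MemLp (g t) 2 μ
  condExp_mem : ∀ t < T, ∀ᵐ ω ∂μ, μ[g t|ℱ t] ω ∈ subdiff f (x t ω) (y t ω)
  integral_sq_le : ∀ t < T, ∫ ω, ‖g t ω‖ ^ 2 ∂μ ≤ S
  step_x : ∀ t < T, ∀ ω, x (t + 1) ω = x t ω - ηx • (g t ω).fst
  step_y : ∀ t < T, ∀ ω, y (t + 1) ω = proj Y (y t ω + ηy • (g t ω).snd)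

namespace IsNoisyRun

variable {μ : Measure Ω} {ℱ : Filtration ℕ mΩ} {f : E → F → ℝ} {Y : Set F}
  {L : ℝ≥0} {ρ D ηx ηy S : ℝ} {x₀ : E} {T t : ℕ} {x : ℕ → Ω → E} {y : ℕ → Ω → F}
  {g : ℕ → Ω → WithLp 2 (E × F)} (hr : IsNoisyRun μ ℱ f Y ηx ηy S x₀ T x y g)
include hr

theorem aestronglyMeasurable_x (ht : t ≤ T) : AEStronglyMeasurable (x t) μ :=
  ((hr.stronglyMeasurable_x t ht).mono (ℱ.le t)).aestronglyMeasurable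

theorem aestronglyMeasurable_y (ht : t ≤ T) : AEStronglyMeasurable (y t) μ :=
  ((hr.stronglyMeasurable_y t ht).mono (ℱ.le t)).aestronglyMeasurable

theorem integrable_sq_norm (ht : t < T) : Integrable (fun ω => ‖g t ω‖ ^ 2) μ :=
  (hr.memLp t ht).integrable_norm_pow two_ne_zero

variable [IsProbabilityMeasure μ]

theorem integrable_direction (ht : t < T) : Integrable (g t) μ :=
  (hr.memLp t ht).integrable one_le_two

theorem integrable_x (ht : t ≤ T) : Integrable (x t) μ := by
  induction t with
  | zero => simpa only [funext hr.init_x] using integrable_const x₀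
  | succ t ih =>
    have hfst := (WithLp.fstL 2 ℝ E F).integrable_comp (hr.integrable_direction ht)
    exact ((ih (Nat.le_of_succ_le ht)).sub (hfst.smul ηx)).congr
      (ae_of_all _ fun ω => (hr.step_x t ht ω).symm)

theorem integral_norm_step_le (hη : 0 ≤ ηx) (ht : t < T) :
    ∫ ω, ‖x (t + 1) ω - x t ω‖ ∂μ ≤ ηx * √S := by
  refine le_trans ?_ (mul_le_mul_of_nonneg_left
    (integral_norm_le_sqrt (hr.memLp t ht) (hr.integral_sq_le t ht)) hη)
  rw [← integral_const_mul]
  refine integral_mono ((hr.integrable_x ht).sub (hr.integrable_x ht.le)).norm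
    ((hr.integrable_direction ht).norm.const_mul ηx) fun ω => ?_
  simp only [hr.step_x t ht, sub_sub_cancel_left, norm_neg, norm_smul_of_nonneg hη]
  gcongr
  exact WithLp.norm_fst_le _ _

theorem integral_norm_sub_le (hη : 0 ≤ ηx) {s n : ℕ} (hn : s + n ≤ T) :
    ∫ ω, ‖x (s + n) ω - x s ω‖ ∂μ ≤ n * (ηx * √S) := by
  have hstep i (hi : i ∈ Finset.range n) :
      Integrable (fun ω => ‖x (s + (i + 1)) ω - x (s + i) ω‖) μ := by
    have := Finset.mem_range.1 hi
    exact ((hr.integrable_x (by lia)).sub (hr.integrable_x (by lia))).norm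
  calc ∫ ω, ‖x (s + n) ω - x s ω‖ ∂μ
      ≤ ∫ ω, ∑ i ∈ Finset.range n, ‖x (s + (i + 1)) ω - x (s + i) ω‖ ∂μ := by
        refine integral_mono ((hr.integrable_x hn).sub (hr.integrable_x (by lia))).norm
          (integrable_finsetSum _ hstep) fun ω => ?_
        simpa only [dist_eq_norm', add_zero] using
          dist_le_range_sum_dist (fun i => x (s + i) ω) n
    _ = ∑ i ∈ Finset.range n, ∫ ω, ‖x (s + (i + 1)) ω - x (s + i) ω‖ ∂μ :=
        integral_finsetSum _ hstep
    _ ≤ ∑ _i ∈ Finset.range n, ηx * √S := Finset.sum_le_sum fun i hi =>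
        hr.integral_norm_step_le hη (by have := Finset.mem_range.1 hi; lia)
    _ = n * (ηx * √S) := by rw [Finset.sum_const, Finset.card_range, nsmul_eq_mul]

theorem mul_integral_norm_sub_le (hη : 0 ≤ ηx) (hLS : (L : ℝ) ^ 2 ≤ S) {s n : ℕ}
    (hn : s + n ≤ T) : L * ∫ ω, ‖x (s + n) ω - x s ω‖ ∂μ ≤ n * (S * ηx) := by
  have hS : √S * √S = S := Real.mul_self_sqrt ((sq_nonneg _).trans hLS)
  calc L * ∫ ω, ‖x (s + n) ω - x s ω‖ ∂μ
      ≤ √S * (n * (ηx * √S)) := mul_le_mul (Real.le_sqrt_of_sq_le hLS)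
        (hr.integral_norm_sub_le hη hn) (by positivity) (by positivity)
    _ = n * (√S * √S * ηx) := by ring
    _ = n * (S * ηx) := by rw [hS]

variable (hf : IsWellPosed f Y L ρ D)
include hf

theorem integrable_dualGap (ht : t ≤ T) : Integrable (fun ω => dualGap f Y (x t ω) (y t ω)) μ :=
  hf.toIsNonconvexConcave.integrable_dualGap (hr.aestronglyMeasurable_x ht)
    (hr.aestronglyMeasurable_y ht) (hr.mem_y t ht)

theorem integral_dualGap_le_of_dualGap_le (hη : 0 ≤ ηx) (hLS : (L : ℝ) ^ 2 ≤ S) {w : Ω → F}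
    {s n : ℕ} (hn : s + n ≤ T) (hw : AEStronglyMeasurable w μ) (hwY : ∀ ω, w ω ∈ Y) {δ : ℝ}
    (hδ : ∀ ω, dualGap f Y (x s ω) (w ω) ≤ δ) :
    ∫ ω, dualGap f Y (x (s + n) ω) (w ω) ∂μ ≤ δ + 2 * (n * (S * ηx)) := by
  have hdist : Integrable (fun ω => ‖x (s + n) ω - x s ω‖) μ :=
    ((hr.integrable_x hn).sub (hr.integrable_x (by lia))).norm
  calc ∫ ω, dualGap f Y (x (s + n) ω) (w ω) ∂μ
      ≤ ∫ ω, (δ + 2 * L * ‖x (s + n) ω - x s ω‖) ∂μ :=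
        integral_mono (hf.toIsNonconvexConcave.integrable_dualGap (hr.aestronglyMeasurable_x hn)
          hw hwY) ((integrable_const δ).add (hdist.const_mul _)) fun ω =>
          (hf.dualGap_le_dualGap_add _ _ (hwY ω)).trans (add_le_add_left (hδ ω) _)
    _ = δ + 2 * (L * ∫ ω, ‖x (s + n) ω - x s ω‖ ∂μ) := by
        rw [integral_add (integrable_const δ) (hdist.const_mul _), integral_const_mul,
          integral_const, probReal_univ, one_smul, mul_assoc]
    _ ≤ δ + 2 * (n * (S * ηx)) :=
        add_le_add_right (mul_le_mul_of_nonneg_left (hr.mul_integral_norm_sub_le hη hLS hn)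
          zero_le_two) δ

variable [CompleteSpace E]

theorem integrable_sq_norm_moreauGrad (ht : t ≤ T) :
    Integrable (fun ω => ‖moreauGrad (primal f Y) ρ (x t ω)‖ ^ 2) μ :=
  hf.moreauRegular.integrable_sq_norm_moreauGrad (hf.lipschitzWith_primal hf.nonempty)
    (hr.aestronglyMeasurable_x ht)

theorem integrable_moreauEnvelope (ht : t ≤ T) :
    Integrable (fun ω => moreauEnvelope (primal f Y) (1 / (2 * ρ)) (x t ω)) μ :=
  hf.moreauRegular.integrable_moreauEnvelope (hf.lipschitzWith_primal hf.nonempty)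
    (hr.integrable_x ht)

theorem half_mul_integral_sq_norm_moreauGrad_le (hη : 0 ≤ ηx) (hη' : 2 * ρ * ηx ≤ 1) (ht : t ≤ T) :
    ηx / 2 * ∫ ω, ‖moreauGrad (primal f Y) ρ (x t ω)‖ ^ 2 ∂μ
      ≤ ∫ ω, moreauEnvelope (primal f Y) (1 / (2 * ρ)) (x t ω) ∂μ - ⨅ w, primal f Y w := by
  have henv := hr.integrable_moreauEnvelope hf ht
  calc ηx / 2 * ∫ ω, ‖moreauGrad (primal f Y) ρ (x t ω)‖ ^ 2 ∂μ
      = ∫ ω, ηx / 2 * ‖moreauGrad (primal f Y) ρ (x t ω)‖ ^ 2 ∂μ := (integral_const_mul _ _).symm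
    _ ≤ ∫ ω, (moreauEnvelope (primal f Y) (1 / (2 * ρ)) (x t ω) - ⨅ w, primal f Y w) ∂μ :=
        integral_mono ((hr.integrable_sq_norm_moreauGrad hf ht).const_mul _)
          (henv.sub (integrable_const _)) fun ω => by
            have hgrad := mul_le_mul_of_nonneg_left
              (hf.moreauRegular.sq_norm_moreauGrad_le (x t ω)) (by positivity : 0 ≤ ηx / 2)
            have hinf := mul_le_mul_of_nonneg_right hη'
              (sub_nonneg.2 (hf.moreauRegular.iInf_le_moreauEnvelope (x t ω)))
            simp only
            linarith
    _ = _ := by rw [integral_sub henv (integrable_const _), integral_const, probReal_univ, one_smul]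

variable [CompleteSpace F]

theorem half_integral_sq_norm_moreauGrad_le (ht : t < T) :
    (∫ ω, ‖moreauGrad (primal f Y) ρ (x t ω)‖ ^ 2 ∂μ) / 2
        - 2 * ρ * ∫ ω, dualGap f Y (x t ω) (y t ω) ∂μ
      ≤ ∫ ω, inner ℝ (g t ω).fst (moreauGrad (primal f Y) ρ (x t ω)) ∂μ := by
  have hgrad := hr.integrable_sq_norm_moreauGrad hf ht.le
  have hgap := hr.integrable_dualGap hf ht.le
  have hmeas := hf.moreauRegular.continuous_moreauGrad.comp_stronglyMeasurable
    (hr.stronglyMeasurable_x t ht.le)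
  have hbound ω := hf.moreauRegular.norm_moreauGrad_le (hf.lipschitzWith_primal hf.nonempty) (x t ω)
  rw [← integral_inner_fst_condExp (ℱ.le t) (hr.integrable_direction ht) hmeas hbound,
    ← integral_div, ← integral_const_mul, ← integral_sub (hgrad.div_const 2) (hgap.const_mul _)]
  refine integral_mono_ae ((hgrad.div_const 2).sub (hgap.const_mul _))
    (integrable_inner_of_norm_le ((WithLp.fstL 2 ℝ E F).integrable_comp integrable_condExp)
      (hmeas.mono (ℱ.le t)).aestronglyMeasurable hbound) ?_
  filter_upwards [hr.condExp_mem t ht] with ω hω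
  exact hf.half_sq_norm_moreauGrad_le_inner_fst (hr.mem_y t ht.le ω) hω

theorem integral_moreauEnvelope_succ_le (hη : 0 ≤ ηx) (ht : t < T) :
    ∫ ω, moreauEnvelope (primal f Y) (1 / (2 * ρ)) (x (t + 1) ω) ∂μ
      ≤ ∫ ω, moreauEnvelope (primal f Y) (1 / (2 * ρ)) (x t ω) ∂μ
        - ηx * ((∫ ω, ‖moreauGrad (primal f Y) ρ (x t ω)‖ ^ 2 ∂μ) / 2
          - 2 * ρ * ∫ ω, dualGap f Y (x t ω) (y t ω) ∂μ) + ρ * ηx ^ 2 * S := by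
  have henv := hr.integrable_moreauEnvelope hf ht.le
  have hsq := hr.integrable_sq_norm ht
  have hinner : Integrable
      (fun ω => inner ℝ (g t ω).fst (moreauGrad (primal f Y) ρ (x t ω))) μ :=
    integrable_inner_of_norm_le ((WithLp.fstL 2 ℝ E F).integrable_comp (hr.integrable_direction ht))
      (hf.moreauRegular.continuous_moreauGrad.comp_aestronglyMeasurable
        (hr.aestronglyMeasurable_x ht.le))
      fun ω => hf.moreauRegular.norm_moreauGrad_le (hf.lipschitzWith_primal hf.nonempty) (x t ω)
  have hlin : Integrable (fun ω => moreauEnvelope (primal f Y) (1 / (2 * ρ)) (x t ω)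
      - ηx * inner ℝ (g t ω).fst (moreauGrad (primal f Y) ρ (x t ω))) μ :=
    henv.sub (hinner.const_mul _)
  calc ∫ ω, moreauEnvelope (primal f Y) (1 / (2 * ρ)) (x (t + 1) ω) ∂μ
      ≤ ∫ ω, (moreauEnvelope (primal f Y) (1 / (2 * ρ)) (x t ω)
        - ηx * inner ℝ (g t ω).fst (moreauGrad (primal f Y) ρ (x t ω))
        + ρ * ηx ^ 2 * ‖g t ω‖ ^ 2) ∂μ := by
        refine integral_mono (hr.integrable_moreauEnvelope hf ht)
          (hlin.add (hsq.const_mul _)) fun ω => ?_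
        have hdescent := hf.moreauRegular.moreauEnvelope_le_add_inner (x t ω) (x (t + 1) ω)
        have hfst := mul_le_mul_of_nonneg_left (pow_le_pow_left₀ (norm_nonneg _)
          (WithLp.norm_fst_le _ (g t ω)) 2) (mul_nonneg hf.pos.le (sq_nonneg ηx))
        rw [hr.step_x t ht, sub_sub_cancel_left, inner_neg_right, real_inner_smul_right, norm_neg,
          norm_smul_of_nonneg hη, mul_pow, real_inner_comm] at hdescent
        simp only [hr.step_x t ht]
        linarith
    _ = ∫ ω, moreauEnvelope (primal f Y) (1 / (2 * ρ)) (x t ω) ∂μ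
        - ηx * ∫ ω, inner ℝ (g t ω).fst (moreauGrad (primal f Y) ρ (x t ω)) ∂μ
        + ρ * ηx ^ 2 * ∫ ω, ‖g t ω‖ ^ 2 ∂μ := by
        rw [integral_add hlin (hsq.const_mul _),
          integral_sub henv (hinner.const_mul _), integral_const_mul, integral_const_mul]
    _ ≤ _ := by
        have := hf.pos
        gcongr
        · exact hr.half_integral_sq_norm_moreauGrad_le hf ht
        · exact hr.integral_sq_le t ht

theorem half_sum_integral_sq_norm_moreauGrad_le (hη : 0 ≤ ηx) (hη' : 2 * ρ * ηx ≤ 1) :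
    ηx / 2 * ∑ t ∈ Finset.range (T + 1), ∫ ω, ‖moreauGrad (primal f Y) ρ (x t ω)‖ ^ 2 ∂μ
      ≤ gap f Y x₀ + 2 * ρ * ηx * ∑ t ∈ Finset.range T, ∫ ω, dualGap f Y (x t ω) (y t ω) ∂μ
        + T * (ρ * ηx ^ 2 * S) := by
  have htelescope n (hn : n ≤ T) :
      ηx / 2 * ∑ t ∈ Finset.range n, ∫ ω, ‖moreauGrad (primal f Y) ρ (x t ω)‖ ^ 2 ∂μ
      ≤ primal f Y x₀ - ∫ ω, moreauEnvelope (primal f Y) (1 / (2 * ρ)) (x n ω) ∂μ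
        + 2 * ρ * ηx * ∑ t ∈ Finset.range n, ∫ ω, dualGap f Y (x t ω) (y t ω) ∂μ
        + n * (ρ * ηx ^ 2 * S) := by
    induction n with
    | zero => simpa [hr.init_x] using hf.moreauRegular.moreauEnvelope_le x₀
    | succ n ih =>
      have hdescent := hr.integral_moreauEnvelope_succ_le hf hη hn
      rw [Finset.sum_range_succ, Finset.sum_range_succ]
      push_cast
      linarith [ih (Nat.le_of_succ_le hn)]
  have hlast := hr.half_mul_integral_sq_norm_moreauGrad_le hf hη hη' le_rfl
  rw [Finset.sum_range_succ, gap]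
  linarith [htelescope T le_rfl]

theorem integral_dualGap_sub_le_integral_inner_snd {w : Ω → F} (hw : StronglyMeasurable[ℱ t] w)
    (hwY : ∀ ω, w ω ∈ Y) (ht : t < T) :
    ∫ ω, dualGap f Y (x t ω) (y t ω) ∂μ - ∫ ω, dualGap f Y (x t ω) (w ω) ∂μ
      ≤ ∫ ω, inner ℝ (g t ω).snd (w ω - y t ω) ∂μ := by
  have hgap := hr.integrable_dualGap hf ht.le
  have hgapw : Integrable (fun ω => dualGap f Y (x t ω) (w ω)) μ :=
    hf.toIsNonconvexConcave.integrable_dualGap (hr.aestronglyMeasurable_x ht.le)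
      (hw.mono (ℱ.le t)).aestronglyMeasurable hwY
  have hmeas : StronglyMeasurable[ℱ t] fun ω => w ω - y t ω :=
    hw.sub (hr.stronglyMeasurable_y t ht.le)
  have hbound ω : ‖w ω - y t ω‖ ≤ D :=
    dist_eq_norm (w ω) (y t ω) ▸ hf.dist_le (hwY ω) (hr.mem_y t ht.le ω)
  rw [← integral_sub hgap hgapw,
    ← integral_inner_snd_condExp (ℱ.le t) (hr.integrable_direction ht) hmeas hbound]
  refine integral_mono_ae (hgap.sub hgapw)
    (integrable_inner_of_norm_le ((WithLp.sndL 2 ℝ E F).integrable_comp integrable_condExp)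
      (hmeas.mono (ℱ.le t)).aestronglyMeasurable hbound) ?_
  filter_upwards [hr.condExp_mem t ht] with ω hω
  simpa [dualGap] using
    sub_le_inner_snd_of_mem_subdiff hf.lipschitz.continuous hf.concave hω (w ω)

theorem integral_dualGap_le_of_sq_norm_sub (hη : 0 ≤ ηy) {w : Ω → F}
    (hw : StronglyMeasurable[ℱ t] w) (hwY : ∀ ω, w ω ∈ Y) (ht : t < T) :
    2 * ηy * ∫ ω, dualGap f Y (x t ω) (y t ω) ∂μ
      ≤ 2 * ηy * ∫ ω, dualGap f Y (x t ω) (w ω) ∂μ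
        + (∫ ω, ‖y t ω - w ω‖ ^ 2 ∂μ - ∫ ω, ‖y (t + 1) ω - w ω‖ ^ 2 ∂μ) + ηy ^ 2 * S := by
  have hwm := (hw.mono (ℱ.le t)).aestronglyMeasurable (μ := μ)
  have hdist {s : ℕ} (hs : s ≤ T) : Integrable (fun ω => ‖y s ω - w ω‖ ^ 2) μ :=
    hf.integrable_sq_norm_sub (hr.aestronglyMeasurable_y hs) (hr.mem_y s hs) hwm hwY
  have hsq := hr.integrable_sq_norm ht
  have hinner : Integrable (fun ω => inner ℝ (g t ω).snd (w ω - y t ω)) μ :=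
    integrable_inner_of_norm_le ((WithLp.sndL 2 ℝ E F).integrable_comp (hr.integrable_direction ht))
      (hwm.sub (hr.aestronglyMeasurable_y ht.le))
      fun ω => dist_eq_norm (w ω) (y t ω) ▸ hf.dist_le (hwY ω) (hr.mem_y t ht.le ω)
  have hadd : Integrable (fun ω => ‖y t ω - w ω‖ ^ 2 + ηy ^ 2 * ‖g t ω‖ ^ 2) μ :=
    (hdist ht.le).add (hsq.const_mul _)
  have hproj : ∫ ω, ‖y (t + 1) ω - w ω‖ ^ 2 ∂μ
      ≤ ∫ ω, (‖y t ω - w ω‖ ^ 2 + ηy ^ 2 * ‖g t ω‖ ^ 2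
        - 2 * ηy * inner ℝ (g t ω).snd (w ω - y t ω)) ∂μ := by
    refine integral_mono (hdist ht) (hadd.sub (hinner.const_mul _)) fun ω => ?_
    simp only [hr.step_y t ht]
    refine (norm_proj_add_smul_sub_sq_le hf.nonempty hf.closed hf.convex ηy (y t ω) (g t ω).snd
      (hwY ω)).trans ?_
    gcongr
    exact WithLp.norm_snd_le _ _
  rw [integral_sub hadd (hinner.const_mul _), integral_add (hdist ht.le) (hsq.const_mul _),
    integral_const_mul, integral_const_mul] at hproj
  have hvar := mul_le_mul_of_nonneg_left (hr.integral_sq_le t ht) (sq_nonneg ηy)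
  have hcond := mul_le_mul_of_nonneg_left
    (hr.integral_dualGap_sub_le_integral_inner_snd hf hw hwY ht) (by positivity : 0 ≤ 2 * ηy)
  linarith

theorem sum_integral_dualGap_le_add [SecondCountableTopology F] (hηx : 0 ≤ ηx) (hηy : 0 < ηy)
    (hLS : (L : ℝ) ^ 2 ≤ S) {b : ℝ} {s n : ℕ} (hn : s + n ≤ T) (hnb : (n : ℝ) - 1 ≤ b) {δ : ℝ}
    (hδ : 0 < δ) :
    ∑ i ∈ Finset.range n, ∫ ω, dualGap f Y (x (s + i) ω) (y (s + i) ω) ∂μ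
      ≤ D ^ 2 / (2 * ηy) + n * (ηy * S / 2 + 2 * (b * (S * ηx)) + δ) := by
  have hS : 0 ≤ S := (sq_nonneg _).trans hLS
  obtain ⟨w, hw, hwY, hwδ⟩ := hf.exists_stronglyMeasurable_dualGap_le hf.nonempty
    (hr.stronglyMeasurable_x s (by lia)) hδ
  have hwm := (hw.mono (ℱ.le s)).aestronglyMeasurable (μ := μ)
  let d (i : ℕ) : ℝ := ∫ ω, ‖y (s + i) ω - w ω‖ ^ 2 ∂μ
  have hd₀ : d 0 ≤ D ^ 2 := by
    have := integral_mono_of_nonneg (ae_of_all μ fun ω => sq_nonneg _) (integrable_const (D ^ 2))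
      (ae_of_all μ fun ω => hf.sq_norm_sub_le (hr.mem_y s (by lia) ω) (hwY ω))
    simpa [d] using this
  have hdn : 0 ≤ d n := integral_nonneg fun ω => sq_nonneg _
  have hstep i (hi : i ∈ Finset.range n) : ∫ ω, dualGap f Y (x (s + i) ω) (y (s + i) ω) ∂μ
      ≤ (d i - d (i + 1)) / (2 * ηy) + (ηy * S / 2 + 2 * (b * (S * ηx)) + δ) := by
    have hin : i + 1 ≤ n := Finset.mem_range.1 hi
    have hib : (i : ℝ) ≤ b := by linarith [(by exact_mod_cast hin : (i : ℝ) + 1 ≤ n)]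
    have hdual : 2 * ηy * ∫ ω, dualGap f Y (x (s + i) ω) (y (s + i) ω) ∂μ
        ≤ 2 * ηy * ∫ ω, dualGap f Y (x (s + i) ω) (w ω) ∂μ + (d i - d (i + 1)) + ηy ^ 2 * S :=
      hr.integral_dualGap_le_of_sq_norm_sub hf hηy.le (hw.mono (ℱ.mono (by lia))) hwY (by lia)
    have hdrift : ∫ ω, dualGap f Y (x (s + i) ω) (w ω) ∂μ ≤ δ + 2 * (b * (S * ηx)) :=
      (hr.integral_dualGap_le_of_dualGap_le hf hηx hLS (by lia) hwm hwY hwδ).trans (by gcongr)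
    rw [div_add' _ _ _ (by positivity), le_div_iff₀ (by positivity)]
    linarith [mul_le_mul_of_nonneg_left hdrift (by positivity : 0 ≤ 2 * ηy)]
  calc ∑ i ∈ Finset.range n, ∫ ω, dualGap f Y (x (s + i) ω) (y (s + i) ω) ∂μ
      ≤ ∑ i ∈ Finset.range n,
        ((d i - d (i + 1)) / (2 * ηy) + (ηy * S / 2 + 2 * (b * (S * ηx)) + δ)) :=
        Finset.sum_le_sum hstep
    _ = (d 0 - d n) / (2 * ηy) + n * (ηy * S / 2 + 2 * (b * (S * ηx)) + δ) := by
        rw [Finset.sum_add_distrib, ← Finset.sum_div, Finset.sum_range_sub', Finset.sum_const,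
          Finset.card_range, nsmul_eq_mul]
    _ ≤ D ^ 2 / (2 * ηy) + n * (ηy * S / 2 + 2 * (b * (S * ηx)) + δ) := by
        gcongr
        linarith

theorem sum_integral_dualGap_le [SecondCountableTopology F] (hηx : 0 ≤ ηx) (hηy : 0 < ηy)
    (hLS : (L : ℝ) ^ 2 ≤ S) {b : ℝ} {s n : ℕ} (hn : s + n ≤ T) (hnb : (n : ℝ) - 1 ≤ b) :
    ∑ i ∈ Finset.range n, ∫ ω, dualGap f Y (x (s + i) ω) (y (s + i) ω) ∂μ
      ≤ D ^ 2 / (2 * ηy) + n * (ηy * S / 2 + 2 * (b * (S * ηx))) := by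
  refine le_of_forall_pos_le_add fun e he => (hr.sum_integral_dualGap_le_add hf hηx hηy hLS hn hnb
    (by positivity : 0 < e / (n + 1))).trans ?_
  have : n * (e / (n + 1)) ≤ e := by
    rw [mul_div_assoc', div_le_iff₀ (by positivity)]
    linarith
  linarith

end IsNoisyRun

end NoisyRun

section StepSizes

/-- The quantity `ρ² S D² / ε⁴`, which governs both the separation between the two step sizes and
the complexity; `S` bounds the second moment of the directions. -/
noncomputable def timescaleRatio (ρ D S ε : ℝ) : ℝ := ρ ^ 2 * S * D ^ 2 / ε ^ 4

/-- The complexity `(ρ S Δ / ε⁴) max {1, ρ² S D² / ε⁴}` of the methods, up to a constant. -/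
noncomputable def iterationBound (ρ D S ε Δ : ℝ) : ℝ :=
  ρ * S * Δ / ε ^ 4 * max 1 (timescaleRatio ρ D S ε)

/-- Step sizes for the accuracy `ε` along directions of second moment at most `S`. The
deterministic method takes `c = 1` and the stochastic one `c = 2`. -/
structure IsStepSizes (ρ D S ε c ηx ηy : ℝ) : Prop where
  rho_pos : 0 < ρ
  diam_pos : 0 < D
  moment_pos : 0 < S
  eps_pos : 0 < ε
  one_le : 1 ≤ c
  le_two : c ≤ 2
  eq_x : ηx = min (ε ^ 2 / (48 * ρ * S)) (ε ^ 6 / (65536 * c * ρ ^ 3 * S ^ 2 * D ^ 2))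
  eq_y : ηy = ε ^ 2 / (16 * c * ρ * S)

namespace IsStepSizes

variable {ρ D S ε c ηx ηy Δ : ℝ} {T : ℕ} (h : IsStepSizes ρ D S ε c ηx ηy)
include h

theorem c_pos : 0 < c := zero_lt_one.trans_le h.one_le

theorem x_pos : 0 < ηx := by
  have := h.c_pos
  obtain ⟨hρ, hD, hS, hε, -, -, hx, -⟩ := h
  rw [hx]
  positivity

theorem y_pos : 0 < ηy := by
  have := h.c_pos
  obtain ⟨hρ, -, hS, hε, -, -, -, hy⟩ := h
  rw [hy]
  positivity

theorem timescaleRatio_pos : 0 < timescaleRatio ρ D S ε := by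
  obtain ⟨hρ, hD, hS, hε, -⟩ := h
  unfold timescaleRatio
  positivity

theorem mul_x_le : ρ * S * ηx ≤ ε ^ 2 / 48 := by
  obtain ⟨hρ, -, hS, -, -, -, hx, -⟩ := h
  calc ρ * S * ηx ≤ ρ * S * (ε ^ 2 / (48 * ρ * S)) := by
        gcongr
        exact hx ▸ min_le_left _ _
    _ = ε ^ 2 / 48 := by field_simp

theorem mul_x_mul_timescaleRatio_le :
    ρ * S * ηx * (c * timescaleRatio ρ D S ε) ≤ ε ^ 2 / 65536 := by
  have hκ := h.timescaleRatio_pos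
  have hc := h.c_pos
  obtain ⟨hρ, hD, hS, hε, -, -, hx, -⟩ := h
  calc ρ * S * ηx * (c * timescaleRatio ρ D S ε)
      ≤ ρ * S * (ε ^ 6 / (65536 * c * ρ ^ 3 * S ^ 2 * D ^ 2)) * (c * timescaleRatio ρ D S ε) := by
        gcongr
        exact hx ▸ min_le_right _ _
    _ = ε ^ 2 / 65536 := by
        rw [timescaleRatio]
        field_simp

theorem two_mul_mul_x_le_one (hS : ε ^ 2 ≤ 4 * S) : 2 * ρ * ηx ≤ 1 := by
  refine le_of_mul_le_mul_left ?_ h.moment_pos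
  linarith [h.mul_x_le, h.moment_pos]

theorem sq_eps_le :
    ε ^ 2 ≤ 2 ^ 17 * (ρ * S * ηx * max 1 (timescaleRatio ρ D S ε)) := by
  have hκ := h.timescaleRatio_pos
  have hc := h.c_pos
  obtain ⟨hρ, hD, hS, hε, -, hc2, hx, -⟩ := h
  suffices hle : ε ^ 2 / (2 ^ 17 * (ρ * S * max 1 (timescaleRatio ρ D S ε))) ≤ ηx by
    rw [div_le_iff₀ (by positivity)] at hle
    linarith
  rw [hx]
  refine le_min ?_ ?_
  · refine div_le_div_of_nonneg_left (by positivity) (by positivity) ?_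
    have : ρ * S * 1 ≤ ρ * S * max 1 (timescaleRatio ρ D S ε) := by
      gcongr
      exact le_max_left _ _
    linarith [mul_pos hρ hS]
  · have hsecond : ε ^ 6 / (65536 * c * ρ ^ 3 * S ^ 2 * D ^ 2)
        = ε ^ 2 / (65536 * (c * (ρ * S * timescaleRatio ρ D S ε))) := by
      rw [timescaleRatio]
      field_simp
    rw [hsecond]
    refine div_le_div_of_nonneg_left (by positivity) (by positivity) ?_
    have : c * (ρ * S * timescaleRatio ρ D S ε)
        ≤ 2 * (ρ * S * max 1 (timescaleRatio ρ D S ε)) := by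
      gcongr
      exact le_max_right _ _
    linarith

theorem exists_nat_le_iterationBound (hΔ : 0 ≤ Δ) :
    ∃ N : ℕ, (N : ℝ) ≤ 2 ^ 20 * iterationBound ρ D S ε Δ ∧
      ∀ T : ℕ, N ≤ T → 2 ^ 20 * iterationBound ρ D S ε Δ < T + 1 := by
  obtain ⟨hρ, -, hS, hε, -⟩ := h
  have hbound : 0 ≤ iterationBound ρ D S ε Δ := by
    unfold iterationBound
    positivity
  refine ⟨⌊2 ^ 20 * iterationBound ρ D S ε Δ⌋₊, Nat.floor_le (by positivity), fun T hT => ?_⟩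
  exact_mod_cast Nat.lt_of_floor_lt (Nat.lt_succ_of_le hT)

theorem two_pow_mul_lt (hT : 2 ^ 20 * iterationBound ρ D S ε Δ < T + 1) :
    2 ^ 20 * (ρ * S * Δ * max 1 (timescaleRatio ρ D S ε)) < (T + 1) * ε ^ 4 := by
  have := h.eps_pos
  rwa [iterationBound, div_mul_eq_mul_div, mul_div_assoc', div_lt_iff₀ (by positivity)] at hT

theorem gap_le (hT : 2 ^ 20 * iterationBound ρ D S ε Δ < T + 1) :
    Δ ≤ ηx * ((T + 1) * (ε ^ 2 / 8)) := by
  have hlt := h.two_pow_mul_lt hT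
  have hε2 := h.sq_eps_le
  obtain ⟨hρ, -, hS, hε, -⟩ := h
  have hpos : 0 < ρ * S * max 1 (timescaleRatio ρ D S ε) * ε ^ 2 := by positivity
  refine le_of_mul_le_mul_left ?_ hpos
  linarith [mul_le_mul hlt.le hε2 (by positivity) (by positivity)]

theorem rho_mul_gap_le (hΔ : 0 ≤ Δ) (hS : ε ^ 2 ≤ 4 * S)
    (hT : 2 ^ 20 * iterationBound ρ D S ε Δ < T + 1)
    (hTκ : (T : ℝ) + 1 ≤ 512 * (c * timescaleRatio ρ D S ε)) : ρ * Δ ≤ ε ^ 2 / 256 := by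
  have hκ := h.timescaleRatio_pos
  have hlt := h.two_pow_mul_lt hT
  obtain ⟨hρ, -, -, hε, -, hc2, -⟩ := h
  have hcκ : c * timescaleRatio ρ D S ε ≤ 2 * max 1 (timescaleRatio ρ D S ε) := by
    gcongr
    exact le_max_right _ _
  have hpos : 0 < max 1 (timescaleRatio ρ D S ε) * ε ^ 2 := by positivity
  refine le_of_mul_le_mul_left ?_ hpos
  have hsmall : ρ * Δ * max 1 (timescaleRatio ρ D S ε) * ε ^ 2
      ≤ ρ * Δ * max 1 (timescaleRatio ρ D S ε) * (4 * S) := by gcongr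
  have hlong : (T + 1) * ε ^ 4 ≤ 1024 * max 1 (timescaleRatio ρ D S ε) * ε ^ 4 := by
    gcongr
    linarith
  linarith

theorem four_mul_sq_diam_div_eq :
    4 * ρ * (D ^ 2 / (2 * ηy)) = 32 * (c * timescaleRatio ρ D S ε) * ε ^ 2 := by
  have := h.c_pos
  obtain ⟨hρ, hD, hS, hε, -, -, -, hy⟩ := h
  rw [hy, timescaleRatio]
  field_simp
  ring

theorem four_mul_y_mul_le : 4 * ρ * (ηy * S / 2) ≤ ε ^ 2 / 8 := by
  have := h.c_pos
  obtain ⟨hρ, -, hS, -, hc, -, -, hy⟩ := h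
  calc 4 * ρ * (ηy * S / 2) = ε ^ 2 / (8 * c) := by
        rw [hy]
        field_simp
        ring
    _ ≤ ε ^ 2 / 8 := div_le_div_of_nonneg_left (by positivity) (by positivity) (by linarith)

theorem blocks_mul_le {B : ℝ} (hκB : 512 * (c * timescaleRatio ρ D S ε) ≤ B) (hBT : B ≤ T + 1) :
    (T / B + 1) * (4 * ρ * (D ^ 2 / (2 * ηy))) ≤ (T + 1) * (ε ^ 2 / 8) := by
  have hκ := mul_pos h.c_pos h.timescaleRatio_pos
  have hB : 0 < B := by linarith
  have hblocks : T / B + 1 ≤ 2 * (T + 1) / B := by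
    rw [le_div_iff₀ hB, add_mul, div_mul_cancel₀ _ hB.ne']
    linarith
  rw [h.four_mul_sq_diam_div_eq]
  calc (T / B + 1) * (32 * (c * timescaleRatio ρ D S ε) * ε ^ 2)
      ≤ 2 * (T + 1) / B * (32 * (B / 512) * ε ^ 2) := by
        gcongr
        linarith
    _ = (T + 1) * (ε ^ 2 / 8) := by
        field_simp
        ring

end IsStepSizes

end StepSizes

section Accuracy

theorem sum_range_le_of_blocks {a : ℕ → ℝ} {B T : ℕ} (hB : 0 < B) {c d : ℝ} (hc : 0 ≤ c)
    (h : ∀ s n, n ≤ B → s + n ≤ T → ∑ i ∈ Finset.range n, a (s + i) ≤ c + n * d) :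
    ∑ i ∈ Finset.range T, a i ≤ (T / B + 1) * c + T * d := by
  suffices hsuffix : ∀ k s, s + k ≤ T →
      ∑ i ∈ Finset.range k, a (s + i) ≤ ((k : ℝ) / B + 1) * c + k * d by
    simpa using hsuffix T 0 (by lia)
  intro k
  induction k using Nat.strong_induction_on with
  | _ k ih =>
    intro s hs
    rcases le_or_gt k B with hk | hk
    · have : 0 ≤ (k : ℝ) / B * c := by positivity
      linarith [h s k hk hs]
    · obtain ⟨r, rfl⟩ := Nat.exists_eq_add_of_le hk.le
      have hfirst := h s B le_rfl (by lia)
      have hrest := ih r (by lia) (s + B) (by lia)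
      simp only [add_assoc] at hrest
      have hB' : (B : ℝ) ≠ 0 := by exact_mod_cast hB.ne'
      rw [Finset.sum_range_add]
      push_cast
      rw [add_div, div_self hB']
      linarith

variable {E F Ω : Type*} [NormedAddCommGroup E] [InnerProductSpace ℝ E] [CompleteSpace E]
  [NormedAddCommGroup F] [InnerProductSpace ℝ F] {mΩ : MeasurableSpace Ω}

namespace IsNoisyRun

variable {μ : Measure Ω} [IsProbabilityMeasure μ] {ℱ : Filtration ℕ mΩ} {f : E → F → ℝ} {Y : Set F}
  {L : ℝ≥0} {ρ D ηx ηy S ε c : ℝ} {x₀ : E} {T t : ℕ} {x : ℕ → Ω → E} {y : ℕ → Ω → F}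
  {g : ℕ → Ω → WithLp 2 (E × F)} (hr : IsNoisyRun μ ℱ f Y ηx ηy S x₀ T x y g)
  (hf : IsWellPosed f Y L ρ D) (hLS : (L : ℝ) ^ 2 ≤ S)
include hr hf hLS

theorem integral_sq_norm_moreauGrad_le (ht : t ≤ T) :
    ∫ ω, ‖moreauGrad (primal f Y) ρ (x t ω)‖ ^ 2 ∂μ ≤ 4 * S := by
  calc ∫ ω, ‖moreauGrad (primal f Y) ρ (x t ω)‖ ^ 2 ∂μ
      ≤ ∫ _, (2 * (L : ℝ)) ^ 2 ∂μ :=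
        integral_mono (hr.integrable_sq_norm_moreauGrad hf ht) (integrable_const _) fun ω =>
          pow_le_pow_left₀ (norm_nonneg _)
            (hf.moreauRegular.norm_moreauGrad_le (hf.lipschitzWith_primal hf.nonempty) _) 2
    _ = 4 * (L : ℝ) ^ 2 := by
        rw [integral_const, probReal_univ, one_smul]
        ring
    _ ≤ 4 * S := by gcongr

theorem integral_sq_norm_moreauGrad_le_gap_add (hη : 0 ≤ ηx) (ht : t ≤ T) :
    ∫ ω, ‖moreauGrad (primal f Y) ρ (x t ω)‖ ^ 2 ∂μ
      ≤ 4 * ρ * (gap f Y x₀ + t * (S * ηx)) := by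
  have hρ := hf.pos
  have hdist : Integrable (fun ω => ‖x t ω - x 0 ω‖) μ :=
    ((hr.integrable_x ht).sub (hr.integrable_x (Nat.zero_le T))).norm
  have hpointwise ω : ‖moreauGrad (primal f Y) ρ (x t ω)‖ ^ 2
      ≤ 4 * ρ * (gap f Y x₀ + L * ‖x t ω - x 0 ω‖) := by
    have hlip := (hf.lipschitzWith_primal hf.nonempty).le_add_mul (x t ω) x₀
    rw [dist_eq_norm] at hlip
    refine (hf.moreauRegular.sq_norm_moreauGrad_le (x t ω)).trans ?_
    rw [gap, hr.init_x]
    gcongr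
    linarith [hf.moreauRegular.moreauEnvelope_le (x t ω)]
  have hdrift := hr.mul_integral_norm_sub_le hη hLS (by lia : 0 + t ≤ T)
  rw [zero_add] at hdrift
  calc ∫ ω, ‖moreauGrad (primal f Y) ρ (x t ω)‖ ^ 2 ∂μ
      ≤ ∫ ω, 4 * ρ * (gap f Y x₀ + L * ‖x t ω - x 0 ω‖) ∂μ :=
        integral_mono (hr.integrable_sq_norm_moreauGrad hf ht)
          (((integrable_const _).add (hdist.const_mul _)).const_mul _) hpointwise
    _ = 4 * ρ * (gap f Y x₀ + L * ∫ ω, ‖x t ω - x 0 ω‖ ∂μ) := by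
        rw [integral_const_mul, integral_add (integrable_const _) (hdist.const_mul _),
          integral_const_mul, integral_const, probReal_univ, one_smul]
    _ ≤ 4 * ρ * (gap f Y x₀ + t * (S * ηx)) := by gcongr

variable (hη : IsStepSizes ρ D S ε c ηx ηy)
  (hT : 2 ^ 20 * iterationBound ρ D S ε (gap f Y x₀) < T + 1)
include hη hT

theorem integral_sq_norm_moreauGrad_le_of_short (hS : ε ^ 2 ≤ 4 * S)
    (hTκ : (T : ℝ) + 1 ≤ 512 * (c * timescaleRatio ρ D S ε)) (ht : t ≤ T) :
    ∫ ω, ‖moreauGrad (primal f Y) ρ (x t ω)‖ ^ 2 ∂μ ≤ ε ^ 2 := by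
  have htκ : (t : ℝ) ≤ 512 * (c * timescaleRatio ρ D S ε) := by
    linarith [(by exact_mod_cast ht : (t : ℝ) ≤ T)]
  have hpos : 0 ≤ ρ * S * ηx :=
    mul_nonneg (mul_nonneg hη.rho_pos.le hη.moment_pos.le) hη.x_pos.le
  have hgap : ρ * gap f Y x₀ ≤ ε ^ 2 / 256 :=
    hη.rho_mul_gap_le (hf.gap_nonneg x₀) hS hT hTκ
  linarith [hr.integral_sq_norm_moreauGrad_le_gap_add hf hLS hη.x_pos.le ht,
    mul_le_mul_of_nonneg_left htκ hpos, hη.mul_x_mul_timescaleRatio_le, sq_nonneg ε]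

variable [CompleteSpace F] [SecondCountableTopology F]

omit hT in
theorem four_mul_sum_integral_dualGap_le {B : ℕ} (hκB : 512 * (c * timescaleRatio ρ D S ε) ≤ B)
    (hBκ : (B : ℝ) - 1 ≤ 512 * (c * timescaleRatio ρ D S ε)) (hBT : B ≤ T + 1) :
    4 * ρ * ∑ t ∈ Finset.range T, ∫ ω, dualGap f Y (x t ω) (y t ω) ∂μ
      ≤ (T + 1) * (ε ^ 2 / 8) + T * (ε ^ 2 / 8 + ε ^ 2 / 16) := by
  have hηy := hη.y_pos
  have hκ := mul_pos hη.c_pos hη.timescaleRatio_pos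
  have hB : 0 < B := Nat.cast_pos.1 ((mul_pos (by norm_num) hκ).trans_le hκB)
  have hblocks := sum_range_le_of_blocks (T := T)
    (a := fun t => ∫ ω, dualGap f Y (x t ω) (y t ω) ∂μ)
    (d := ηy * S / 2 + 2 * (512 * (c * timescaleRatio ρ D S ε) * (S * ηx)))
    hB (by positivity : 0 ≤ D ^ 2 / (2 * ηy)) fun s n hnB hn =>
      hr.sum_integral_dualGap_le hf hη.x_pos.le hηy hLS hn
        (by linarith [(by exact_mod_cast hnB : (n : ℝ) ≤ B)])
  have hsteps : 4 * ρ * (ηy * S / 2 + 2 * (512 * (c * timescaleRatio ρ D S ε) * (S * ηx)))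
      ≤ ε ^ 2 / 8 + ε ^ 2 / 16 := by
    linarith [hη.four_mul_y_mul_le, hη.mul_x_mul_timescaleRatio_le]
  linarith [hη.blocks_mul_le hκB (by exact_mod_cast hBT),
    mul_le_mul_of_nonneg_left hblocks (by linarith [hη.rho_pos] : 0 ≤ 4 * ρ),
    mul_le_mul_of_nonneg_left hsteps (Nat.cast_nonneg (α := ℝ) T)]

theorem sum_integral_sq_norm_moreauGrad_le_of_long (hS : ε ^ 2 ≤ 4 * S) {B : ℕ}
    (hκB : 512 * (c * timescaleRatio ρ D S ε) ≤ B)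
    (hBκ : (B : ℝ) - 1 ≤ 512 * (c * timescaleRatio ρ D S ε)) (hBT : B ≤ T + 1) :
    ∑ t ∈ Finset.range (T + 1), ∫ ω, ‖moreauGrad (primal f Y) ρ (x t ω)‖ ^ 2 ∂μ
      ≤ (T + 1) * ε ^ 2 := by
  have hdescent := hr.half_sum_integral_sq_norm_moreauGrad_le hf hη.x_pos.le
    (hη.two_mul_mul_x_le_one hS)
  have hdual := hr.four_mul_sum_integral_dualGap_le hf hLS hη hκB hBκ hBT
  have hT₀ : (0 : ℝ) ≤ T := Nat.cast_nonneg T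
  refine le_of_mul_le_mul_left ?_ hη.x_pos
  linarith [hη.gap_le hT, mul_le_mul_of_nonneg_left hdual hη.x_pos.le,
    mul_le_mul_of_nonneg_left (mul_le_mul_of_nonneg_left hη.mul_x_le hT₀) hη.x_pos.le,
    mul_nonneg hη.x_pos.le (mul_nonneg hT₀ (sq_nonneg ε)), mul_nonneg hη.x_pos.le (sq_nonneg ε)]

theorem sum_integral_sq_norm_moreauGrad_le :
    ∑ t ∈ Finset.range (T + 1), ∫ ω, ‖moreauGrad (primal f Y) ρ (x t ω)‖ ^ 2 ∂μ
      ≤ (T + 1) * ε ^ 2 := by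
  have hsum (hle : ∀ t ≤ T, ∫ ω, ‖moreauGrad (primal f Y) ρ (x t ω)‖ ^ 2 ∂μ ≤ ε ^ 2) :
      ∑ t ∈ Finset.range (T + 1), ∫ ω, ‖moreauGrad (primal f Y) ρ (x t ω)‖ ^ 2 ∂μ
        ≤ (T + 1) * ε ^ 2 := by
    simpa using Finset.sum_le_card_nsmul (Finset.range (T + 1)) _ _
      fun t ht => hle t (Finset.mem_range_succ_iff.1 ht)
  rcases le_total (4 * S) (ε ^ 2) with hS | hS
  · exact hsum fun t ht => (hr.integral_sq_norm_moreauGrad_le hf hLS ht).trans hS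
  have hκ := mul_pos hη.c_pos hη.timescaleRatio_pos
  have hBκ := Nat.ceil_lt_add_one (by positivity : 0 ≤ 512 * (c * timescaleRatio ρ D S ε))
  rcases le_or_gt ⌈512 * (c * timescaleRatio ρ D S ε)⌉₊ (T + 1) with hB | hB
  · exact hr.sum_integral_sq_norm_moreauGrad_le_of_long hf hLS hη hT hS (Nat.le_ceil _)
      (by linarith) hB
  · refine hsum fun t ht => hr.integral_sq_norm_moreauGrad_le_of_short hf hLS hη hT hS ?_ ht
    exact_mod_cast (Nat.lt_ceil.1 hB).le

end IsNoisyRun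

end Accuracy

section ReturnedIterate

instance (T : ℕ) : IsProbabilityMeasure (uniformIndex T) := by
  unfold uniformIndex
  infer_instance

theorem integral_uniformIndex (T : ℕ) (u : ℕ → ℝ) :
    ∫ i, u i ∂uniformIndex T = (∑ t ∈ Finset.range (T + 1), u t) / (T + 1) := by
  rw [uniformIndex, PMF.integral_eq_sum, Finset.sum_range, Finset.sum_div]
  simp [div_eq_inv_mul, ENNReal.toReal_add]

theorem integrable_prod_uniformIndex {Ω : Type*} {mΩ : MeasurableSpace Ω} {μ : Measure Ω}
    [SFinite μ] {T : ℕ} {u : ℕ → Ω → ℝ} (hu : ∀ t ≤ T, Measurable (u t))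
    (hint : ∀ t ≤ T, Integrable (u t) μ) :
    Integrable (fun s : Ω × Fin (T + 1) => u s.2 s.1) (μ.prod (uniformIndex T)) := by
  have hmeas : Measurable fun s : Ω × Fin (T + 1) => u s.2 s.1 :=
    measurable_from_prod_countable_left fun i => hu i i.is_le
  rw [integrable_prod_iff' hmeas.aestronglyMeasurable]
  exact ⟨ae_of_all _ fun i => hint i i.is_le, .of_finite⟩

theorem integral_prod_uniformIndex {Ω : Type*} {mΩ : MeasurableSpace Ω} {μ : Measure Ω}
    [SFinite μ] {T : ℕ} {u : ℕ → Ω → ℝ} (hu : ∀ t ≤ T, Measurable (u t))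
    (hint : ∀ t ≤ T, Integrable (u t) μ) :
    ∫ s : Ω × Fin (T + 1), u s.2 s.1 ∂μ.prod (uniformIndex T)
      = (∑ t ∈ Finset.range (T + 1), ∫ ω, u t ω ∂μ) / (T + 1) := by
  rw [integral_prod_symm _ (integrable_prod_uniformIndex hu hint)]
  exact integral_uniformIndex T fun t => ∫ ω, u t ω ∂μ

variable {V Ω : Type*} [NormedAddCommGroup V] [InnerProductSpace ℝ V] [CompleteSpace V]
  {mΩ : MeasurableSpace Ω} {P : Measure Ω} {h : V → ℝ} {ρ ε : ℝ} {X : Ω → V}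

theorem IsEpsStationaryInMean.exists_isEpsStationary [IsProbabilityMeasure P]
    (hX : IsEpsStationaryInMean P h ρ ε X) (hε : 0 ≤ ε) : ∃ ω, IsEpsStationary h ρ ε (X ω) := by
  obtain ⟨ω, hω⟩ := exists_le_integral hX.2.1
  exact ⟨ω, hX.1 ω, (sq_le_sq₀ (norm_nonneg _) hε).1 (hω.trans hX.2.2)⟩

theorem IsEpsStationaryInMean.comp_of_map {Ω' : Type*} [MeasurableSpace Ω'] {φ : Ω' → Ω}
    {Q : Measure Ω'} (hφ : AEMeasurable φ Q) (hX : IsEpsStationaryInMean (Q.map φ) h ρ ε X) :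
    IsEpsStationaryInMean Q h ρ ε (X ∘ φ) :=
  ⟨fun ω => hX.1 (φ ω), hX.2.1.comp_aemeasurable hφ,
    (integral_map hφ hX.2.1.1).symm.trans_le hX.2.2⟩

theorem IsNoisyRun.isEpsStationaryInMean {E F Ω : Type*} [NormedAddCommGroup E]
    [InnerProductSpace ℝ E] [CompleteSpace E] [NormedAddCommGroup F] [InnerProductSpace ℝ F]
    [CompleteSpace F] [SecondCountableTopology F] {mΩ : MeasurableSpace Ω} {μ : Measure Ω}
    [IsProbabilityMeasure μ] {ℱ : Filtration ℕ mΩ} {f : E → F → ℝ} {Y : Set F} {L : ℝ≥0}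
    {ρ D ηx ηy S ε c : ℝ} {x₀ : E} {T : ℕ} {x : ℕ → Ω → E} {y : ℕ → Ω → F}
    {g : ℕ → Ω → WithLp 2 (E × F)} (hr : IsNoisyRun μ ℱ f Y ηx ηy S x₀ T x y g)
    (hf : IsWellPosed f Y L ρ D) (hLS : (L : ℝ) ^ 2 ≤ S) (hη : IsStepSizes ρ D S ε c ηx ηy)
    (hT : 2 ^ 20 * iterationBound ρ D S ε (gap f Y x₀) < T + 1) :
    IsEpsStationaryInMean (μ.prod (uniformIndex T)) (primal f Y) ρ ε
      fun s : Ω × Fin (T + 1) => x s.2 s.1 := by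
  let u (t : ℕ) (ω : Ω) : ℝ := ‖moreauGrad (primal f Y) ρ (x t ω)‖ ^ 2
  have hu t (ht : t ≤ T) : Measurable (u t) :=
    ((hf.moreauRegular.continuous_moreauGrad.norm.pow 2).comp_stronglyMeasurable
      ((hr.stronglyMeasurable_x t ht).mono (ℱ.le t))).measurable
  have hint t (ht : t ≤ T) : Integrable (u t) μ := hr.integrable_sq_norm_moreauGrad hf ht
  refine ⟨fun _ => hf.moreauRegular.differentiable_moreauEnvelope _,
    integrable_prod_uniformIndex hu hint, (integral_prod_uniformIndex hu hint).trans_le ?_⟩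
  rw [div_le_iff₀' (by positivity)]
  exact hr.sum_integral_sq_norm_moreauGrad_le hf hLS hη hT

end ReturnedIterate

section FreshSample

variable {Ω S Ξ K : Type*} {m mΩ : MeasurableSpace Ω} [MeasurableSpace S] [MeasurableSpace Ξ]
  [NormedAddCommGroup K] {μ : Measure Ω} {ν : Measure Ξ} {W : Ω → S} {ζ : Ω → Ξ}

theorem map_restrict_prodMk_of_indep [IsFiniteMeasure μ] (hm : m ≤ mΩ) (hW : Measurable[m] W)
    (hζ : Measurable ζ) (hind : Indep m (MeasurableSpace.comap ζ inferInstance) μ) {A : Set Ω}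
    (hA : MeasurableSet[m] A) :
    (μ.restrict A).map (fun ω => (W ω, ζ ω)) = ((μ.restrict A).map W).prod (μ.map ζ) := by
  have hW' := hW.mono hm le_rfl
  refine (Measure.prod_eq fun B C hB hC => ?_).symm
  rw [Measure.map_apply (hW'.prodMk hζ) (hB.prod hC), Measure.map_apply hW' hB,
    Measure.map_apply hζ hC, Measure.restrict_apply ((hW'.prodMk hζ) (hB.prod hC)),
    Measure.restrict_apply (hW' hB), mk_preimage_prod, inter_right_comm]
  exact (Indep_iff _ _ _).1 hind _ _ ((hW hB).inter hA) ⟨C, hC, rfl⟩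

section ProductLaw

variable (hW : Measurable W) (hζ : Measurable ζ)
  (hlaw : μ.map (fun ω => (W ω, ζ ω)) = (μ.map W).prod ν)
include hW hζ hlaw

theorem lintegral_comp_prodMk [SFinite ν] {φ : S × Ξ → ENNReal} (hφ : Measurable φ) :
    ∫⁻ ω, φ (W ω, ζ ω) ∂μ = ∫⁻ ω, ∫⁻ s, φ (W ω, s) ∂ν ∂μ := by
  rw [← lintegral_map hφ (hW.prodMk hζ), hlaw, lintegral_prod _ hφ.aemeasurable,
    lintegral_map hφ.lintegral_prod_right' hW]

variable {H : S × Ξ → K} (hH : StronglyMeasurable H)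
include hH

theorem integrable_prod_of_map_prodMk (hint : Integrable (fun ω => H (W ω, ζ ω)) μ) :
    Integrable H ((μ.map W).prod ν) := by
  rwa [← hlaw, integrable_map_measure hH.aestronglyMeasurable (hW.prodMk hζ).aemeasurable]

variable [SFinite ν]

section Bochner

variable [NormedSpace ℝ K]

theorem integrable_integral_comp_prodMk (hint : Integrable (fun ω => H (W ω, ζ ω)) μ) :
    Integrable (fun ω => ∫ s, H (W ω, s) ∂ν) μ :=
  (integrable_prod_of_map_prodMk hW hζ hlaw hH hint).integral_prod_left.comp_measurable hW

theorem integral_comp_prodMk [SFinite μ] (hint : Integrable (fun ω => H (W ω, ζ ω)) μ) :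
    ∫ ω, H (W ω, ζ ω) ∂μ = ∫ ω, ∫ s, H (W ω, s) ∂ν ∂μ := by
  have hprod := integrable_prod_of_map_prodMk hW hζ hlaw hH hint
  rw [← integral_map (hW.prodMk hζ).aemeasurable hH.aestronglyMeasurable, hlaw,
    integral_prod _ hprod,
    integral_map hW.aemeasurable hprod.integral_prod_left.aestronglyMeasurable]

end Bochner

variable [IsProbabilityMeasure μ] (hLp : ∀ ω, MemLp (fun s => H (W ω, s)) 2 ν) {C : ℝ}
  (hC : ∀ ω, ∫ s, ‖H (W ω, s)‖ ^ 2 ∂ν ≤ C)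
include hLp hC

theorem lintegral_sq_norm_comp_prodMk_le :
    ∫⁻ ω, ENNReal.ofReal (‖H (W ω, ζ ω)‖ ^ 2) ∂μ ≤ ENNReal.ofReal C := by
  calc ∫⁻ ω, ENNReal.ofReal (‖H (W ω, ζ ω)‖ ^ 2) ∂μ
      = ∫⁻ ω, ∫⁻ s, ENNReal.ofReal (‖H (W ω, s)‖ ^ 2) ∂ν ∂μ :=
        lintegral_comp_prodMk hW hζ hlaw (hH.norm.pow 2).measurable.ennreal_ofReal
    _ ≤ ∫⁻ _, ENNReal.ofReal C ∂μ := lintegral_mono fun ω => by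
        rw [← ofReal_integral_eq_lintegral_ofReal ((hLp ω).integrable_norm_pow two_ne_zero)
          (ae_of_all _ fun s => sq_nonneg _)]
        exact ENNReal.ofReal_le_ofReal (hC ω)
    _ = ENNReal.ofReal C := by simp

theorem memLp_two_comp_prodMk : MemLp (fun ω => H (W ω, ζ ω)) 2 μ := by
  have hmeas := (hH.comp_measurable (hW.prodMk hζ)).aestronglyMeasurable (μ := μ)
  refine (memLp_two_iff_integrable_sq_norm hmeas).2 ⟨hmeas.norm.pow 2, ?_⟩
  rw [hasFiniteIntegral_iff_ofReal (ae_of_all _ fun ω => sq_nonneg _)]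
  exact (lintegral_sq_norm_comp_prodMk_le hW hζ hlaw hH hLp hC).trans_lt ENNReal.ofReal_lt_top

theorem integral_sq_norm_comp_prodMk_le : ∫ ω, ‖H (W ω, ζ ω)‖ ^ 2 ∂μ ≤ C := by
  have hint :=
    (memLp_two_comp_prodMk hW hζ hlaw hH hLp hC).integrable_norm_pow two_ne_zero
  obtain ⟨ω₀⟩ := nonempty_of_isProbabilityMeasure μ
  have hC₀ : 0 ≤ C := (integral_nonneg fun s => sq_nonneg _).trans (hC ω₀)
  rw [← ENNReal.ofReal_le_ofReal_iff hC₀,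
    ofReal_integral_eq_lintegral_ofReal hint (ae_of_all _ fun ω => sq_nonneg _)]
  exact lintegral_sq_norm_comp_prodMk_le hW hζ hlaw hH hLp hC

end ProductLaw

theorem condExp_comp_prodMk [NormedSpace ℝ K] [CompleteSpace K] [IsFiniteMeasure μ] (hm : m ≤ mΩ)
    (hW : Measurable[m] W) (hζ : Measurable ζ)
    (hind : Indep m (MeasurableSpace.comap ζ inferInstance) μ)
    {H : S × Ξ → K} (hH : StronglyMeasurable H) (hint : Integrable (fun ω => H (W ω, ζ ω)) μ) :
    μ[fun ω => H (W ω, ζ ω)|m] =ᵐ[μ] fun ω => ∫ s, H (W ω, s) ∂μ.map ζ := by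
  have hW' := hW.mono hm le_rfl
  refine (ae_eq_condExp_of_forall_setIntegral_eq hm hint (fun A hA _ => ?_) (fun A hA _ => ?_)
    (hH.integral_prod_right'.comp_measurable hW).aestronglyMeasurable).symm
  all_goals have hlaw := map_restrict_prodMk_of_indep hm hW hζ hind hA
  · exact integrable_integral_comp_prodMk hW' hζ hlaw hH hint.restrict
  · exact (integral_comp_prodMk hW' hζ hlaw hH hint.restrict).symm

end FreshSample

section Runs

variable {E F Ω Ξ : Type*} [NormedAddCommGroup E] [InnerProductSpace ℝ E]
  [NormedAddCommGroup F] [InnerProductSpace ℝ F] [CompleteSpace F] {m mΩ : MeasurableSpace Ω}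
  {μ : Measure Ω} {f : E → F → ℝ} {Y : Set F} {L : ℝ≥0} {ρ D σ ε c ηx ηy : ℝ} {x₀ : E} {y₀ : F}
  {T t : ℕ}

section Deterministic

variable {x : ℕ → E} {y : ℕ → F}

theorem IsTTGDARun.snd_mem {αx αy : ℕ → ℝ} (hr : IsTTGDARun f Y αx αy x₀ y₀ T x y)
    (hcl : IsClosed Y) (hco : Convex ℝ Y) (hy₀ : y₀ ∈ Y) (ht : t ≤ T) : y t ∈ Y := by
  cases t with
  | zero => exact hr.init_y ▸ hy₀
  | succ t =>
    obtain ⟨g, -, -, hstep⟩ := hr.step t ht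
    exact hstep ▸ (proj_spec ⟨y₀, hy₀⟩ hcl hco _).1

variable (hr : IsTTGDARun f Y (fun _ => ηx) (fun _ => ηy) x₀ y₀ T x y)
include hr

theorem IsTTGDARun.exists_isNoisyRun (hf : IsNonconvexConcave f Y L ρ D) (hy₀ : y₀ ∈ Y) :
    ∃ g, IsNoisyRun (Measure.dirac ()) ⊤ f Y ηx ηy (L ^ 2) x₀ T (fun t _ => x t)
      (fun t _ => y t) g := by
  choose! g hmem hx hy using hr.step
  refine ⟨fun t _ => g t, fun _ => hr.init_x, fun t _ => stronglyMeasurable_const,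
    fun t _ => stronglyMeasurable_const, fun t ht _ => hr.snd_mem hf.closed hf.convex hy₀ ht,
    fun t _ => memLp_const _, fun t ht => ae_of_all _ fun _ => ?_, fun t ht => ?_,
    fun t ht _ => hx t ht, fun t ht _ => hy t ht⟩
  · rw [condExp_const ((⊤ : Filtration ℕ _).le t)]
    exact hmem t ht
  · simpa using pow_le_pow_left₀ (norm_nonneg _)
      (norm_le_of_mem_clarkeSubdifferential hf.lipschitz (hmem t ht)) 2

theorem IsTTGDARun.isEpsStationaryInMean [CompleteSpace E] [SecondCountableTopology F]
    (hf : IsWellPosed f Y L ρ D) (hy₀ : y₀ ∈ Y) (hη : IsStepSizes ρ D (L ^ 2) ε c ηx ηy)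
    (hT : 2 ^ 20 * iterationBound ρ D (L ^ 2) ε (gap f Y x₀) < T + 1) :
    IsEpsStationaryInMean (uniformIndex T) (primal f Y) ρ ε fun i : Fin (T + 1) => x i := by
  obtain ⟨g, hrun⟩ := hr.exists_isNoisyRun hf.toIsNonconvexConcave hy₀
  have hmean := hrun.isEpsStationaryInMean hf le_rfl hη hT
  rw [Measure.dirac_prod] at hmean
  exact IsEpsStationaryInMean.comp_of_map (φ := Prod.mk ())
    measurable_prodMk_left.aemeasurable hmean

end Deterministic

theorem integral_sq_norm_eq_add {K : Type*} [NormedAddCommGroup K] [InnerProductSpace ℝ K]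
    [CompleteSpace K] [IsProbabilityMeasure μ] {u : Ω → K} (hu : MemLp u 2 μ) :
    ∫ ω, ‖u ω‖ ^ 2 ∂μ = ∫ ω, ‖u ω - ∫ ω', u ω' ∂μ‖ ^ 2 ∂μ + ‖∫ ω, u ω ∂μ‖ ^ 2 := by
  set a := ∫ ω, u ω ∂μ
  have hdev : MemLp (fun ω => u ω - a) 2 μ := hu.sub (memLp_const a)
  have hcross : ∫ ω, inner ℝ (u ω - a) a ∂μ = 0 := by
    have hint := hu.integrable one_le_two
    simp_rw [real_inner_comm a]
    rw [integral_inner (hdev.integrable one_le_two), integral_sub hint (integrable_const a),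
      integral_const, probReal_univ, one_smul, sub_self, inner_zero_right]
  have hinner : Integrable (fun ω => 2 * inner ℝ (u ω - a) a) μ :=
    ((hdev.integrable one_le_two).inner_const a).const_mul 2
  have hsq := hdev.integrable_norm_pow two_ne_zero
  have hadd : Integrable (fun ω => ‖u ω - a‖ ^ 2 + 2 * inner ℝ (u ω - a) a) μ := hsq.add hinner
  calc ∫ ω, ‖u ω‖ ^ 2 ∂μ
      = ∫ ω, (‖u ω - a‖ ^ 2 + 2 * inner ℝ (u ω - a) a + ‖a‖ ^ 2) ∂μ := by
        simp only [← norm_add_sq_real, sub_add_cancel]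
    _ = ∫ ω, ‖u ω - a‖ ^ 2 ∂μ + ‖a‖ ^ 2 := by
        rw [integral_add hadd (integrable_const _), integral_add hsq hinner,
          integral_const_mul, hcross, integral_const, probReal_univ, one_smul, mul_zero, add_zero]

section Stochastic

variable {G : E → F → Ξ → WithLp 2 (E × F)} {M : ℕ}

theorem ttsgda_snd_mem (hcl : IsClosed Y) (hco : Convex ℝ Y) (hy₀ : y₀ ∈ Y) {αx αy : ℕ → ℝ}
    (ζ : ℕ → Fin M → Ξ) : ∀ t, (ttsgda Y αx αy G x₀ y₀ ζ t).2 ∈ Y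
  | 0 => hy₀
  | _ + 1 => (proj_spec ⟨y₀, hy₀⟩ hcl hco _).1

variable [MeasurableSpace Ξ] {ν : Measure Ξ} {ξ : ℕ → Fin M → Ω → Ξ}

/-- The filtration of the σ-algebras generated by the samples drawn before time `t`. -/
def sampleFiltration (hξ : ∀ t i, Measurable (ξ t i)) : Filtration ℕ mΩ where
  seq t := ⨆ p ∈ {p : ℕ × Fin M | p.1 < t}, MeasurableSpace.comap (ξ p.1 p.2) inferInstance
  mono' _ _ hst := biSup_mono fun _ hp => lt_of_lt_of_le hp hst
  le' _ := iSup₂_le fun p _ => (hξ p.1 p.2).comap_le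

theorem measurable_sampleFiltration (hξ : ∀ t i, Measurable (ξ t i)) {s : ℕ} (hs : s < t)
    (i : Fin M) : Measurable[sampleFiltration hξ t] (ξ s i) :=
  measurable_iff_comap_le.2 <| le_iSup₂_of_le
    (f := fun (p : ℕ × Fin M) (_ : p ∈ {p : ℕ × Fin M | p.1 < t}) =>
      MeasurableSpace.comap (ξ p.1 p.2) inferInstance) (s, i) hs le_rfl

theorem indep_sampleFiltration (hξ : ∀ t i, Measurable (ξ t i))
    (hind : iIndepFun (fun p : ℕ × Fin M => ξ p.1 p.2) μ) (t : ℕ) (i : Fin M) :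
    Indep (sampleFiltration hξ t) (MeasurableSpace.comap (ξ t i) inferInstance) μ := by
  have hdisj : Disjoint {p : ℕ × Fin M | p.1 < t} {(t, i)} :=
    disjoint_singleton_right.2 (lt_irrefl t)
  have hsup := indep_iSup_of_disjoint (fun p => (hξ p.1 p.2).comap_le) hind.iIndep hdisj
  rwa [iSup_singleton] at hsup

variable [MeasurableSpace E] [MeasurableSpace F]

theorem IsOracle.integral_sq_norm_le [CompleteSpace E] [IsProbabilityMeasure ν]
    (hG : IsOracle f Y ν σ G) (hf : LipschitzWith L (joint f)) (x : E) {y : F} (hy : y ∈ Y) :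
    ∫ s, ‖G x y s‖ ^ 2 ∂ν ≤ L ^ 2 + σ ^ 2 := by
  have hmean := pow_le_pow_left₀ (norm_nonneg _)
    (norm_le_of_mem_clarkeSubdifferential hf (hG.unbiased x y hy)) 2
  linarith [integral_sq_norm_eq_add (hG.memLp x y hy), hG.variance_le x y hy]

variable [SecondCountableTopology E] [BorelSpace E] [SecondCountableTopology F] [BorelSpace F]

theorem measurable_ttsgda (hcl : IsClosed Y) (hco : Convex ℝ Y) (hne : Y.Nonempty)
    (hG : Measurable fun p : (E × F) × Ξ => G p.1.1 p.1.2 p.2) {αx αy : ℕ → ℝ}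
    (hξ : ∀ s < t, ∀ i, Measurable (ξ s i)) :
    Measurable fun ω => ttsgda Y αx αy G x₀ y₀ (fun s i => ξ s i ω) t := by
  induction t with
  | zero => exact measurable_const
  | succ t ih =>
    have ih := ih fun s hs => hξ s (hs.trans t.lt_succ_self)
    let z ω := ttsgda Y αx αy G x₀ y₀ (fun s i => ξ s i ω) t
    have hg : Measurable fun ω => miniBatch G (fun i => ξ t i ω) (z ω).1 (z ω).2 :=
      (Finset.measurable_fun_sum _ fun i _ =>
        hG.comp (ih.prodMk (hξ t t.lt_succ_self i))).const_smul (1 / (M : ℝ))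
    have hfst := (WithLp.fstL 2 ℝ E F).continuous.measurable.comp hg
    have hsnd := (WithLp.sndL 2 ℝ E F).continuous.measurable.comp hg
    have hproj := (lipschitzWith_proj hne hcl hco).continuous.measurable
    exact (ih.fst.sub (hfst.const_smul _)).prodMk (hproj.comp (ih.snd.add (hsnd.const_smul _)))

end Stochastic

section SingleSample

variable [CompleteSpace E] [MeasurableSpace E] [MeasurableSpace F] [SecondCountableTopology E]
  [BorelSpace E] [SecondCountableTopology F] [BorelSpace F] [MeasurableSpace Ξ] {ν : Measure Ξ}
  {G : E → F → Ξ → WithLp 2 (E × F)}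

namespace IsOracle

variable (hG : IsOracle f Y ν σ G) {W : Ω → E × F} {ζ : Ω → Ξ} (hWY : ∀ ω, (W ω).2 ∈ Y)
include hG hWY

theorem condExp_comp_mem_subdiff [IsFiniteMeasure μ] (hm : m ≤ mΩ)
    (hW : Measurable[m] W) (hζ : Measurable ζ)
    (hind : Indep m (MeasurableSpace.comap ζ inferInstance) μ) (hν : μ.map ζ = ν)
    (hint : Integrable (fun ω => G (W ω).1 (W ω).2 (ζ ω)) μ) :
    ∀ᵐ ω ∂μ, μ[fun ω => G (W ω).1 (W ω).2 (ζ ω)|m] ω ∈ subdiff f (W ω).1 (W ω).2 := by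
  filter_upwards [condExp_comp_prodMk (H := fun p => G p.1.1 p.1.2 p.2) hm hW hζ hind
    hG.measurable.stronglyMeasurable hint] with ω hω
  rw [hω, hν]
  exact hG.unbiased _ _ (hWY ω)

variable [IsProbabilityMeasure μ] [IsProbabilityMeasure ν] (hf : LipschitzWith L (joint f))
  (hW : Measurable W) (hζ : Measurable ζ)
  (hlaw : μ.map (fun ω => (W ω, ζ ω)) = (μ.map W).prod ν)
include hf hW hζ hlaw

theorem memLp_comp : MemLp (fun ω => G (W ω).1 (W ω).2 (ζ ω)) 2 μ :=
  memLp_two_comp_prodMk (H := fun p => G p.1.1 p.1.2 p.2) hW hζ hlaw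
    hG.measurable.stronglyMeasurable (fun ω => hG.memLp (W ω).1 (W ω).2 (hWY ω))
    fun ω => (hG.integral_sq_norm_le hf (W ω).1 (hWY ω) :)

theorem integral_sq_norm_comp_le : ∫ ω, ‖G (W ω).1 (W ω).2 (ζ ω)‖ ^ 2 ∂μ ≤ L ^ 2 + σ ^ 2 :=
  integral_sq_norm_comp_prodMk_le (H := fun p => G p.1.1 p.1.2 p.2) hW hζ hlaw
    hG.measurable.stronglyMeasurable (fun ω => hG.memLp (W ω).1 (W ω).2 (hWY ω))
    fun ω => (hG.integral_sq_norm_le hf (W ω).1 (hWY ω) :)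

end IsOracle

variable [IsProbabilityMeasure μ] {ξ : ℕ → Fin 1 → Ω → Ξ} (hy₀ : y₀ ∈ Y) (hG : IsOracle f Y ν σ G)
  (hξ : ∀ t i, Measurable (ξ t i)) (hν : ∀ t i, μ.map (ξ t i) = ν)
  (hind : iIndepFun (fun p : ℕ × Fin 1 => ξ p.1 p.2) μ)
include hy₀ hG hξ hν hind

theorem isNoisyRun_ttsgda (hf : IsNonconvexConcave f Y L ρ D) (T : ℕ) :
    let z t ω := ttsgda Y (fun _ => ηx) (fun _ => ηy) G x₀ y₀ (fun s i => ξ s i ω) t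
    IsNoisyRun μ (sampleFiltration hξ) f Y ηx ηy (L ^ 2 + σ ^ 2) x₀ T (fun t ω => (z t ω).1)
      (fun t ω => (z t ω).2) fun t ω => G (z t ω).1 (z t ω).2 (ξ t 0 ω) := by
  intro z
  have : IsProbabilityMeasure ν :=
    hν 0 0 ▸ Measure.isProbabilityMeasure_map (hξ 0 0).aemeasurable
  have hpast t : Measurable[sampleFiltration hξ t] (z t) :=
    measurable_ttsgda hf.closed hf.convex ⟨y₀, hy₀⟩ hG.measurable fun s hs i =>
      measurable_sampleFiltration hξ hs i
  have hz t : Measurable (z t) := (hpast t).mono ((sampleFiltration hξ).le t) le_rfl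
  have hzY t ω : (z t ω).2 ∈ Y := ttsgda_snd_mem hf.closed hf.convex hy₀ _ t
  have hfresh t := indep_sampleFiltration hξ hind t 0
  have hlaw t : μ.map (fun ω => (z t ω, ξ t 0 ω)) = (μ.map (z t)).prod ν := by
    simpa only [Measure.restrict_univ, hν] using
      map_restrict_prodMk_of_indep
        ((sampleFiltration hξ).le t) (hpast t) (hξ t 0) (hfresh t) .univ
  have hLp t := hG.memLp_comp (hzY t) hf.lipschitz (hz t) (hξ t 0) (hlaw t)
  exact
    { init_x := fun _ => rfl
      stronglyMeasurable_x := fun t _ => (hpast t).fst.stronglyMeasurable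
      stronglyMeasurable_y := fun t _ => (hpast t).snd.stronglyMeasurable
      mem_y := fun t _ => hzY t
      memLp := fun t _ => hLp t
      condExp_mem := fun t _ =>
        hG.condExp_comp_mem_subdiff (hzY t) ((sampleFiltration hξ).le t) (hpast t) (hξ t 0)
          (hfresh t) (hν t 0) ((hLp t).integrable one_le_two)
      integral_sq_le := fun t _ =>
        hG.integral_sq_norm_comp_le (hzY t) hf.lipschitz (hz t) (hξ t 0) (hlaw t)
      step_x := fun t _ ω => by simp [z, ttsgda, miniBatch]
      step_y := fun t _ ω => by simp [z, ttsgda, miniBatch] }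

theorem isEpsStationaryInMean_ttsgda (hf : IsWellPosed f Y L ρ D)
    (hη : IsStepSizes ρ D (L ^ 2 + σ ^ 2) ε c ηx ηy)
    (hT : 2 ^ 20 * iterationBound ρ D (L ^ 2 + σ ^ 2) ε (gap f Y x₀) < T + 1) :
    IsEpsStationaryInMean (μ.prod (uniformIndex T)) (primal f Y) ρ ε
      fun s : Ω × Fin (T + 1) =>
        (ttsgda Y (fun _ => ηx) (fun _ => ηy) G x₀ y₀ (fun t i => ξ t i s.1) s.2).1 :=
  (isNoisyRun_ttsgda hy₀ hG hξ hν hind hf.toIsNonconvexConcave T).isEpsStationaryInMean hf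
    (le_add_of_nonneg_right (sq_nonneg σ)) hη hT

end SingleSample

end Runs

end Minimax

theorem mainTheorem2_general {E F : Type*} [NormedAddCommGroup E] [InnerProductSpace ℝ E]
    [CompleteSpace E] [SecondCountableTopology E] [MeasurableSpace E] [BorelSpace E]
    [NormedAddCommGroup F] [InnerProductSpace ℝ F] [CompleteSpace F] [SecondCountableTopology F]
    [MeasurableSpace F] [BorelSpace F] {f : E → F → ℝ} {Y : Set F} {L : ℝ≥0} {ρ D ε : ℝ} {x₀ : E}
    {y₀ : F} (hL : 0 < L) (hρ : 0 < ρ) (hD : 0 < D) (hε : 0 < ε)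
    (hf : IsNonconvexConcave f Y L ρ D) (hy₀ : y₀ ∈ Y) (hb : BddBelow (Set.range (primal f Y))) :
    (∀ ηx ηy : ℝ,
      ηx = min (ε ^ 2 / (48 * ρ * L ^ 2)) (ε ^ 6 / (65536 * ρ ^ 3 * L ^ 4 * D ^ 2)) →
      ηy = ε ^ 2 / (16 * ρ * L ^ 2) →
      ∃ N : ℕ,
        (N : ℝ) ≤ 2 ^ 20 * (ρ * L ^ 2 * gap f Y x₀ / ε ^ 4 *
          max 1 (ρ ^ 2 * L ^ 2 * D ^ 2 / ε ^ 4)) ∧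
        ∀ T : ℕ, N ≤ ttgdaEvals T → ∀ (x : ℕ → E) (y : ℕ → F),
          IsTTGDARun f Y (fun _ => ηx) (fun _ => ηy) x₀ y₀ T x y →
          IsEpsStationaryInMean (uniformIndex T) (primal f Y) ρ ε (fun i : Fin (T + 1) => x i) ∧
          ∃ t ≤ T, IsEpsStationary (primal f Y) ρ ε (x t)) ∧
    (∀ σ ηx ηy : ℝ,
      ηx = min (ε ^ 2 / (48 * ρ * (L ^ 2 + σ ^ 2)))
        (ε ^ 6 / (131072 * ρ ^ 3 * (L ^ 2 + σ ^ 2) ^ 2 * D ^ 2)) →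
      ηy = ε ^ 2 / (32 * ρ * (L ^ 2 + σ ^ 2)) →
      ∃ N : ℕ,
        (N : ℝ) ≤ 2 ^ 20 * (ρ * (L ^ 2 + σ ^ 2) * gap f Y x₀ / ε ^ 4 *
          max 1 (ρ ^ 2 * (L ^ 2 + σ ^ 2) * D ^ 2 / ε ^ 4)) ∧
        ∀ (Ξ : Type*) [MeasurableSpace Ξ] (ν : Measure Ξ) (G : E → F → Ξ → WithLp 2 (E × F))
          (Ω : Type*) [MeasurableSpace Ω] (μ : Measure Ω) [IsProbabilityMeasure μ]
          (ξ : ℕ → Fin 1 → Ω → Ξ),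
          IsOracle f Y ν σ G →
          (∀ t i, Measurable (ξ t i)) → (∀ t i, μ.map (ξ t i) = ν) →
          iIndepFun (fun p : ℕ × Fin 1 => ξ p.1 p.2) μ →
          ∀ T : ℕ, N ≤ ttsgdaEvals 1 T →
            IsEpsStationaryInMean (μ.prod (uniformIndex T)) (primal f Y) ρ ε
              (fun s : Ω × Fin (T + 1) => (ttsgda Y (fun _ => ηx) (fun _ => ηy) G x₀ y₀
                (fun t i => ξ t i s.1) s.2).1)) := by
  have hf' : IsWellPosed f Y L ρ D := ⟨hf, ⟨y₀, hy₀⟩, hρ, hb⟩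
  refine ⟨fun ηx ηy hηx hηy => ?_, fun σ ηx ηy hηx hηy => ?_⟩
  · have hη : IsStepSizes ρ D (L ^ 2) ε 1 ηx ηy :=
      ⟨hρ, hD, by positivity, hε, le_rfl, one_le_two, by rw [hηx]; ring_nf, by rw [hηy]; ring_nf⟩
    obtain ⟨N, hN, hlt⟩ := hη.exists_nat_le_iterationBound (hf'.gap_nonneg x₀)
    refine ⟨N, hN, fun T hT x y hr => ?_⟩
    have hmean := hr.isEpsStationaryInMean hf' hy₀ hη (hlt T hT)
    obtain ⟨i, hi⟩ := hmean.exists_isEpsStationary hε.le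
    exact ⟨hmean, i, i.is_le, hi⟩
  · have hη : IsStepSizes ρ D (L ^ 2 + σ ^ 2) ε 2 ηx ηy :=
      ⟨hρ, hD, by positivity, hε, one_le_two, le_rfl, by rw [hηx]; ring_nf, by rw [hηy]; ring_nf⟩
    obtain ⟨N, hN, hlt⟩ := hη.exists_nat_le_iterationBound (hf'.gap_nonneg x₀)
    refine ⟨N, hN, fun Ξ _ ν G Ω _ μ _ ξ hG hξ hν hind T hT => ?_⟩
    exact isEpsStationaryInMean_ttsgda hy₀ hG hξ hν hind hf' hη
      (hlt T (by rwa [ttsgdaEvals, one_mul] at hT))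

theorem mainTheorem2 :
    ∃ C : ℝ, 0 < C ∧
      ∀ (m n : ℕ) (f : EuclideanSpace ℝ (Fin m) → EuclideanSpace ℝ (Fin n) → ℝ)
        (Y : Set (EuclideanSpace ℝ (Fin n))) (L : ℝ≥0) (ρ D ε : ℝ)
        (x₀ : EuclideanSpace ℝ (Fin m)) (y₀ : EuclideanSpace ℝ (Fin n)),
        0 < L → 0 < ρ → 0 < D → 0 < ε →
        IsNonconvexConcave f Y L ρ D → y₀ ∈ Y → BddBelow (Set.range (primal f Y)) →
        -- the deterministic method
        (∀ ηx ηy : ℝ,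
          ηx = min (ε ^ 2 / (48 * ρ * L ^ 2)) (ε ^ 6 / (65536 * ρ ^ 3 * L ^ 4 * D ^ 2)) →
          ηy = ε ^ 2 / (16 * ρ * L ^ 2) →
          ∃ N : ℕ,
            (N : ℝ) ≤ C * (ρ * L ^ 2 * gap f Y x₀ / ε ^ 4 *
              max 1 (ρ ^ 2 * L ^ 2 * D ^ 2 / ε ^ 4)) ∧
            ∀ T : ℕ, N ≤ ttgdaEvals T →
              ∀ (x : ℕ → EuclideanSpace ℝ (Fin m)) (y : ℕ → EuclideanSpace ℝ (Fin n)),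
                IsTTGDARun f Y (fun _ => ηx) (fun _ => ηy) x₀ y₀ T x y →
                IsEpsStationaryInMean (uniformIndex T) (primal f Y) ρ ε
                  (fun i : Fin (T + 1) => x i) ∧
                ∃ t ≤ T, IsEpsStationary (primal f Y) ρ ε (x t)) ∧
        -- the stochastic method with batch size one
        (∀ σ ηx ηy : ℝ, 0 ≤ σ →
          ηx = min (ε ^ 2 / (48 * ρ * (L ^ 2 + σ ^ 2)))
            (ε ^ 6 / (131072 * ρ ^ 3 * (L ^ 2 + σ ^ 2) ^ 2 * D ^ 2)) →
          ηy = ε ^ 2 / (32 * ρ * (L ^ 2 + σ ^ 2)) →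
          ∃ N : ℕ,
            (N : ℝ) ≤ C * (ρ * (L ^ 2 + σ ^ 2) * gap f Y x₀ / ε ^ 4 *
              max 1 (ρ ^ 2 * (L ^ 2 + σ ^ 2) * D ^ 2 / ε ^ 4)) ∧
            ∀ (Ξ : Type*) [MeasurableSpace Ξ] (ν : Measure Ξ) [IsProbabilityMeasure ν]
              (G : EuclideanSpace ℝ (Fin m) → EuclideanSpace ℝ (Fin n) → Ξ →
                WithLp 2 (EuclideanSpace ℝ (Fin m) × EuclideanSpace ℝ (Fin n)))
              (Ω : Type*) [MeasurableSpace Ω] (μ : Measure Ω) [IsProbabilityMeasure μ]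
              (ξ : ℕ → Fin 1 → Ω → Ξ),
              IsOracle f Y ν σ G →
              (∀ t i, Measurable (ξ t i)) → (∀ t i, μ.map (ξ t i) = ν) →
              iIndepFun (fun p : ℕ × Fin 1 => ξ p.1 p.2) μ →
              ∀ T : ℕ, N ≤ ttsgdaEvals 1 T →
                IsEpsStationaryInMean (μ.prod (uniformIndex T)) (primal f Y) ρ ε
                  (fun s : Ω × Fin (T + 1) =>
                    (ttsgda Y (fun _ => ηx) (fun _ => ηy) G x₀ y₀
                      (fun t i => ξ t i s.1) s.2).1)) := by
  refine ⟨2 ^ 20, by positivity, fun m n f Y L ρ D ε x₀ y₀ hL hρ hD hε hf hy₀ hb => ?_⟩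
  obtain ⟨hdet, hstoch⟩ := mainTheorem2_general (x₀ := x₀) hL hρ hD hε hf hy₀ hb
  exact ⟨hdet, fun σ ηx ηy _ hηx hηy => (hstoch σ ηx ηy hηx hηy).imp fun N hN =>
    ⟨hN.1, fun Ξ _ ν _ => hN.2 Ξ ν⟩⟩
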